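/- \textbf{Setting.} Let $n,p\ge 1$, $T\ge 0$, $W\ge 1$ be integers. Consider $x_{t+1}=Ax_t+Bu_t$ with $x_t\in\mathbb R^n$, $u_t\in\mathbb R^m$ and any initial state $x_0$, where $(A,B)$ is stabilizable, and let $Q$, $R$ be symmetric positive definite. Let $X$ be the positive semidefinite solution of $X=Q+A^\top XA-A^\top XB(R+B^\top XB)^{-1}B^\top XA$, and put $\Sigma=B^\top XB+R$, $K=\Sigma^{-1}B^\top XA$, $K_i=\Sigma^{-1}B^\top((A-BK)^\top)^iX$. The tracking cost is $$J=\sum_{t=0}^{T-1}\big(\|x_t-r_t\|_Q^2+\|u_t\|_R^2\big)+\|x_T-r_T\|_X^2 .$$ \textbf{Target.} The target states $r_t\in\mathbb R^n$ satisfy $\|r_t\|\le D_r$ for $-p\le t\le T$ and $r_t=S_tz_{t-1}$ for $0\le t\le T$, where $z_t=(r_t^\top,r_{t-1}^\top,\dots,r_{t-p+1}^\top)^\top$ and $S_t\in\mathbb R^{n\times np}$. Let $\mathcal A_t$ be the block companion matrix with first block row $S_t$ and identity blocks below the diagonal, so that $z_t=\mathcal A_tz_{t-1}$, and let $S_{t+k|t}$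 be the first block row of $\mathcal A_{t+k}\cdots\mathcal A_{t+1}$. Assume $\|S_{t+k|t}\|\le M$ (operator norm) whenever $1\le k\le W$, $t\ge -1$ and $t+k\le T$. Let $V_T=\sum_{t=0}^{T-1}\|S_{t+1}-S_t\|_F$. \textbf{PLOT.} Fix a forgetting factor $\gamma\in(0,1)$ and $\varepsilon>0$; let $\mathcal S=\{S\in\mathbb R^{n\times np}:\|S\|\le M\}$ and, for $P\succ0$, let $\Pi^P_{\mathcal S}$ be the projection onto $\mathcal S$ in the norm $\|S\|_{F,P}=\sqrt{\mathrm{tr}(SPS^\top)}$. For each $k=1,\dots,W$, set $P_{t|t-k}=\varepsilon I$ for $-1\le t\le k-2$, choose $\hat S_{t+k|t}\in\mathcal S$ arbitrarily for $-1\le t\le k-2$, and for $t\ge k-1$, once $r_t$ is revealed, put $$P_{t|t-k}=\gamma P_{t-k|t-2k}+z_{t-k}z_{t-k}^\top,\qquad \hat S_{t+k|t}=\Pi_{\mathcal S}^{P_{t|t-k}}\big(\hat S_{t|t-k}+(r_t-\hat S_{t|t-k}z_{t-k})z_{t-k}^\top P_{t|t-k}^{-1}\big).$$ With the predictions $r_{t|t}=r_t$,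 $r_{t+k|t}=\hat S_{t+k|t}z_t$, PLOT applies $$u_t=-K(x_t-r_t)-\sum_{i=t}^{\min\{t+W-1,T-1\}}K_{i-t}(Ar_{i|t}-r_{i+1|t}).$$ \textbf{Claim.} The non-causal LQT policy $u_t^*=-K(x_t-r_t)-\sum_{i=t}^{T-1}K_{i-t}(Ar_i-r_{i+1})$ attains the minimum of $J$ over all input sequences, and the dynamic regret $\mathcal R$ of PLOT, that is, the cost of PLOT minus the cost of $u^*$ from the same $x_0$, satisfies $$\mathcal R\le\alpha_1\frac{\rho^{2W}}{(1-\rho)^2}T+\alpha_2\tilde W^4\frac{V_T}{1-\gamma}-\alpha_3\tilde W^2(T+1)\log\gamma-\alpha_4\tilde W^3\log(1-\gamma)+\alpha_5\tilde W^3 .$$ Here $\rho=\sqrt{1-\lambda_{\min}(Q)/\lambda_{\max}(X)}$, $\tilde W=\min\{W,(1-\rho)^{-1}\}$, $c_0=\frac{\|B\|\lambda_{\max}(X)}{\lambda_{\min}(R)}\sqrt{\frac{\lambda_{\max}(X)}{\lambda_{\min}(X)}}$, and $$\alpha_1=2c_0^2(\|A\|+1)^2D_r^2\|\Sigma\|,\quad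 \alpha_2=4c_0^2\|\Sigma\|\beta_1\sqrt p\max\{M,1\}^2,\quad \alpha_3=\alpha_4=2c_0^2\|\Sigma\|\beta_2,\quad \alpha_5=2c_0^2\|\Sigma\|\beta_4,$$ $$\beta_1=4\sqrt nM(\varepsilon+pD_r^2),\quad \beta_2=np(1+\sqrt pM)^2D_r^2,\quad \beta_4=4\gamma\varepsilon nM^2+\beta_2\log\frac{\varepsilon+pD_r^2}{\varepsilon}.$$ -/

import Mathlib

open scoped Matrix Matrix.Norms.L2Operator

namespace PLOT

noncomputable section

/-! ### Linear quadratic tracking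

Vectors are plain functions `Fin n → ℝ`; the Euclidean norm of `v` is `‖WithLp.toLp 2 v‖`.
The norm `‖·‖` of a matrix is the operator norm induced by the Euclidean norms. -/

/-- Data of a tracking problem: the system `x⁺ = A x + B u` and the weights `Q`, `R`. -/
structure LQT (n m : ℕ) where
  A : Matrix (Fin n) (Fin n) ℝ
  B : Matrix (Fin n) (Fin m) ℝ
  Q : Matrix (Fin n) (Fin n) ℝ
  R : Matrix (Fin m) (Fin m) ℝ

/-- `(A, B)` is stabilizable: for some gain `K₀` all complex eigenvalues of `A - B K₀` lie
strictly inside the unit circle. -/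
def Stabilizable {n m : ℕ} (A : Matrix (Fin n) (Fin n) ℝ) (B : Matrix (Fin n) (Fin m) ℝ) : Prop :=
  ∃ K₀ : Matrix (Fin m) (Fin n) ℝ,
    ∀ μ ∈ spectrum ℂ ((A - B * K₀).map (algebraMap ℝ ℂ)), ‖μ‖ < 1

/-- Largest eigenvalue of a symmetric matrix. -/
def lambdaMax {n : ℕ} (Y : Matrix (Fin n) (Fin n) ℝ) : ℝ := sSup (spectrum ℝ Y)

/-- Smallest eigenvalue of a symmetric matrix. -/
def lambdaMin {n : ℕ} (Y : Matrix (Fin n) (Fin n) ℝ) : ℝ := sInf (spectrum ℝ Y)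

/-- The quadratic form `‖v‖²_Y = vᵀ Y v`. -/
def qform {n : ℕ} (Y : Matrix (Fin n) (Fin n) ℝ) (v : Fin n → ℝ) : ℝ := v ⬝ᵥ (Y *ᵥ v)

namespace LQT

variable {n m : ℕ} (sys : LQT n m)

/-- `Y` is a positive semidefinite solution of the discrete algebraic Riccati equation. -/
def IsRiccatiSolution (Y : Matrix (Fin n) (Fin n) ℝ) : Prop :=
  Y.PosSemidef ∧
    Y = sys.Q + sys.Aᵀ * Y * sys.A
      - sys.Aᵀ * Y * sys.B * (sys.R + sys.Bᵀ * Y * sys.B)⁻¹ * (sys.Bᵀ * Y * sys.A)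

/-- The positive semidefinite solution `X` of the Riccati equation (it exists and is unique when
`(A, B)` is stabilizable and `Q`, `R` are positive definite). -/
def X : Matrix (Fin n) (Fin n) ℝ := Classical.epsilon sys.IsRiccatiSolution

/-- `Σ = Bᵀ X B + R`. -/
def Sig : Matrix (Fin m) (Fin m) ℝ := sys.Bᵀ * sys.X * sys.B + sys.R

/-- Feedback gain `K = Σ⁻¹ Bᵀ X A`. -/
def K : Matrix (Fin m) (Fin n) ℝ := sys.Sig⁻¹ * sys.Bᵀ * sys.X * sys.A

/-- Feedforward gains `K_i = Σ⁻¹ Bᵀ ((A - B K)ᵀ)^i X`. -/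
def Kff (i : ℕ) : Matrix (Fin m) (Fin n) ℝ :=
  sys.Sig⁻¹ * sys.Bᵀ * ((sys.A - sys.B * sys.K)ᵀ) ^ i * sys.X

/-- States produced by the input sequence `u` from `x₀`. -/
def state (x₀ : Fin n → ℝ) (u : ℕ → Fin m → ℝ) : ℕ → Fin n → ℝ
  | 0 => x₀
  | t + 1 => sys.A *ᵥ state x₀ u t + sys.B *ᵥ u t

/-- States produced by the state-feedback policy `π` (time, state ↦ input) from `x₀`. -/
def closedLoop (x₀ : Fin n → ℝ) (π : ℕ → (Fin n → ℝ) → Fin m → ℝ) : ℕ → Fin n → ℝ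
  | 0 => x₀
  | t + 1 => sys.A *ᵥ closedLoop x₀ π t + sys.B *ᵥ π t (closedLoop x₀ π t)

/-- Tracking cost
`∑_{t<T} (‖x_t - r_t‖²_Q + ‖u_t‖²_R) + ‖x_T - r_T‖²_X` of the input sequence `u`. -/
def cost (r : ℤ → Fin n → ℝ) (T : ℕ) (x₀ : Fin n → ℝ) (u : ℕ → Fin m → ℝ) : ℝ :=
  ∑ t ∈ Finset.range T, (qform sys.Q (sys.state x₀ u t - r t) + qform sys.R (u t))
    + qform sys.X (sys.state x₀ u T - r T)

/-- The inputs that the policy `π` applies along its own trajectory. -/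
def inputs (x₀ : Fin n → ℝ) (π : ℕ → (Fin n → ℝ) → Fin m → ℝ) : ℕ → Fin m → ℝ :=
  fun t => π t (sys.closedLoop x₀ π t)

/-- The optimal non-causal policy, which knows `r_0, …, r_T` in advance:
`u_t = -K (x_t - r_t) - ∑_{i=t}^{T-1} K_{i-t} (A r_i - r_{i+1})`. -/
def optimalPolicy (r : ℤ → Fin n → ℝ) (T : ℕ) (t : ℕ) (x : Fin n → ℝ) : Fin m → ℝ :=
  -(sys.K *ᵥ (x - r t))
    - ∑ i ∈ Finset.Ico t T, sys.Kff (i - t) *ᵥ (sys.A *ᵥ r i - r (i + 1))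

/-- Dynamic regret of the policy `π` against the optimal non-causal policy. -/
def regret (r : ℤ → Fin n → ℝ) (T : ℕ) (x₀ : Fin n → ℝ)
    (π : ℕ → (Fin n → ℝ) → Fin m → ℝ) : ℝ :=
  sys.cost r T x₀ (sys.inputs x₀ π) - sys.cost r T x₀ (sys.inputs x₀ (sys.optimalPolicy r T))

/-- Decay rate `ρ = √(1 - λ_min(Q) / λ_max(X))`. -/
def rho : ℝ := √(1 - lambdaMin sys.Q / lambdaMax sys.X)

/-- `c₀ = ‖B‖ λ_max(X) / λ_min(R) · √(λ_max(X) / λ_min(X))`. -/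
def c₀ : ℝ :=
  ‖sys.B‖ * lambdaMax sys.X / lambdaMin sys.R * √(lambdaMax sys.X / lambdaMin sys.X)

end LQT

/-! ### Autoregressive targets -/

/-- Regressor `z_t = (r_t, r_{t-1}, …, r_{t-p+1})`; entry `(a, j)` is `(r_{t-a})_j`. -/
def regressor {n : ℕ} (p : ℕ) (r : ℤ → Fin n → ℝ) (t : ℤ) : Fin p × Fin n → ℝ :=
  fun a => r (t - (a.1 : ℕ)) a.2

/-- Companion matrix of `S`: first block row `S`, identity blocks below the diagonal. -/
def companion {n p : ℕ} (S : Matrix (Fin n) (Fin p × Fin n) ℝ) :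
    Matrix (Fin p × Fin n) (Fin p × Fin n) ℝ :=
  Matrix.of fun a b =>
    if (a.1 : ℕ) = 0 then S a.2 b
    else if (a.1 : ℕ) = (b.1 : ℕ) + 1 ∧ a.2 = b.2 then 1 else 0

/-- `transition S s k = 𝒜_{s+k-1} ⋯ 𝒜_{s+1} 𝒜_s`, with `𝒜_t` the companion matrix of `S_t`.
In the notation `Φ_{t+k|t} = 𝒜_{t+k} ⋯ 𝒜_{t+1}` this is `Φ_{s-1+k|s-1}`. -/
def transition {n p : ℕ} (S : ℕ → Matrix (Fin n) (Fin p × Fin n) ℝ) (s : ℕ) :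
    ℕ → Matrix (Fin p × Fin n) (Fin p × Fin n) ℝ
  | 0 => 1
  | k + 1 => companion (S (s + k)) * transition S s k

/-- The matrix `ℬᵀ` that reads off the first block of a regressor. -/
def firstBlock (n p : ℕ) : Matrix (Fin n) (Fin p × Fin n) ℝ :=
  Matrix.of fun i b => if (b.1 : ℕ) = 0 ∧ i = b.2 then 1 else 0

/-- `multiStep S s k = ℬᵀ Φ_{s-1+k|s-1}`, the matrix `S_{t+k|t}` with `t = s - 1`
(the shift by one lets `t` start at `-1`). -/
def multiStep {n p : ℕ} (S : ℕ → Matrix (Fin n) (Fin p × Fin n) ℝ) (s k : ℕ) :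
    Matrix (Fin n) (Fin p × Fin n) ℝ :=
  firstBlock n p * transition S s k

/-- Frobenius norm. -/
def frob {ι κ : Type*} [Fintype ι] [Fintype κ] (Y : Matrix ι κ ℝ) : ℝ :=
  √(∑ i, ∑ j, Y i j ^ 2)

/-- Total variation `V_T = ∑_{t=0}^{T-1} ‖S_{t+1} - S_t‖_F` of the target dynamics. -/
def pathLength {n p : ℕ} (S : ℕ → Matrix (Fin n) (Fin p × Fin n) ℝ) (T : ℕ) : ℝ :=
  ∑ t ∈ Finset.range T, frob (S (t + 1) - S t)

/-! ### Recursive least squares with forgetting, for `k`-step-ahead prediction -/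

/-- Weighted Frobenius norm `‖Y‖_{F,P} = √tr(Y P Yᵀ)`. -/
def wfrob {n p : ℕ} (P : Matrix (Fin p × Fin n) (Fin p × Fin n) ℝ)
    (Y : Matrix (Fin n) (Fin p × Fin n) ℝ) : ℝ :=
  √(Y * P * Yᵀ).trace

/-- A minimizer of `‖Z - Y‖_{F,P}` over `𝒮 = {Z : ‖Z‖ ≤ M}` (it exists and is unique for `M ≥ 0`
and `P` positive definite). -/
def proj {n p : ℕ} (M : ℝ) (P : Matrix (Fin p × Fin n) (Fin p × Fin n) ℝ)
    (Y : Matrix (Fin n) (Fin p × Fin n) ℝ) : Matrix (Fin n) (Fin p × Fin n) ℝ :=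
  Classical.epsilon fun Z => ‖Z‖ ≤ M ∧
    ∀ Z' : Matrix (Fin n) (Fin p × Fin n) ℝ, ‖Z'‖ ≤ M → wfrob P (Z - Y) ≤ wfrob P (Z' - Y)

/-- State of one least-squares learner: the matrix `P` and the current estimate `Ŝ`. -/
structure Learner (n p : ℕ) where
  P : Matrix (Fin p × Fin n) (Fin p × Fin n) ℝ
  S : Matrix (Fin n) (Fin p × Fin n) ℝ

/-- One update with regressor `z` and observed response `y`: `P⁺ = γ P + z zᵀ` and
`Ŝ⁺ = Π (Ŝ + (y - Ŝ z) zᵀ (P⁺)⁻¹)`, where `Π` is the projection in the norm of `P⁺`. -/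
def rlsStep {n p : ℕ} (γ M : ℝ) (z : Fin p × Fin n → ℝ) (y : Fin n → ℝ) (L : Learner n p) :
    Learner n p where
  P := γ • L.P + Matrix.vecMulVec z z
  S := proj M (γ • L.P + Matrix.vecMulVec z z)
    (L.S + Matrix.vecMulVec (y - L.S *ᵥ z) z * (γ • L.P + Matrix.vecMulVec z z)⁻¹)

/-- Learner `i` (`0 ≤ i < k`) of the `k`-step-ahead predictor after `τ` updates, that is, at time
`τ k + i - 1`. It starts from `P = ε I` and the estimate `S₀`; update number `τ + 1` takes place at
time `(τ + 1) k + i - 1`, uses the target state of that time as response and the regressor of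
`k` steps earlier. -/
def learner {n p : ℕ} (γ ε M : ℝ) (r : ℤ → Fin n → ℝ) (k i : ℕ)
    (S₀ : Matrix (Fin n) (Fin p × Fin n) ℝ) : ℕ → Learner n p
  | 0 => ⟨ε • 1, S₀⟩
  | τ + 1 => rlsStep γ M (regressor p r ((τ : ℤ) * k + i - 1)) (r (((τ : ℤ) + 1) * k + i - 1))
      (learner γ ε M r k i S₀ τ)

/-- The estimate `Ŝ_{t+k|t}`, `k ≥ 1`. At time `t` the learner in charge is `(t + 1) mod k`.
`Sinit k i` is the initial estimate of learner `i` of the `k`-step-ahead predictor. -/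
def estimate {n p : ℕ} (γ ε M : ℝ) (r : ℤ → Fin n → ℝ)
    (Sinit : ℕ → ℕ → Matrix (Fin n) (Fin p × Fin n) ℝ) (k t : ℕ) :
    Matrix (Fin n) (Fin p × Fin n) ℝ :=
  (learner γ ε M r k ((t + 1) % k) (Sinit k ((t + 1) % k)) ((t + 1) / k)).S

/-- The prediction `r_{t+k|t}`: equal to `r_t` for `k = 0` and to `Ŝ_{t+k|t} z_t` for `k ≥ 1`. -/
def prediction {n p : ℕ} (γ ε M : ℝ) (r : ℤ → Fin n → ℝ)
    (Sinit : ℕ → ℕ → Matrix (Fin n) (Fin p × Fin n) ℝ) (k t : ℕ) : Fin n → ℝ :=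
  if k = 0 then r t else estimate γ ε M r Sinit k t *ᵥ regressor p r t

/-- The policy of predictive linear online tracking,
`u_t = -K (x_t - r_t) - ∑_{i=t}^{min(t+W-1, T-1)} K_{i-t} (A r_{i|t} - r_{i+1|t})`. -/
def plot {n m p : ℕ} (sys : LQT n m) (γ ε M : ℝ) (W T : ℕ) (r : ℤ → Fin n → ℝ)
    (Sinit : ℕ → ℕ → Matrix (Fin n) (Fin p × Fin n) ℝ) (t : ℕ) (x : Fin n → ℝ) : Fin m → ℝ :=
  -(sys.K *ᵥ (x - r t))
    - ∑ i ∈ Finset.range (min W (T - t)), sys.Kff i *ᵥ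
        (sys.A *ᵥ prediction γ ε M r Sinit i t - prediction γ ε M r Sinit (i + 1) t)

/-! ### Constants of the regret bound -/

/-- `β₁ = 4 √n M (ε + p D²)`. -/
def β₁ (n p : ℕ) (ε M D : ℝ) : ℝ := 4 * √n * M * (ε + p * D ^ 2)

/-- `β₂ = n p (1 + √p M)² D²`. -/
def β₂ (n p : ℕ) (M D : ℝ) : ℝ := n * p * (1 + √p * M) ^ 2 * D ^ 2

/-- `β₄ = 4 γ ε n M² + β₂ log ((ε + p D²) / ε)`. -/
def β₄ (n p : ℕ) (γ ε M D : ℝ) : ℝ :=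
  4 * γ * ε * n * M ^ 2 + β₂ n p M D * Real.log ((ε + p * D ^ 2) / ε)

variable {n m : ℕ} (sys : LQT n m)

def α₁ (D : ℝ) : ℝ := 2 * sys.c₀ ^ 2 * (‖sys.A‖ + 1) ^ 2 * D ^ 2 * ‖sys.Sig‖

def α₂ (p : ℕ) (ε M D : ℝ) : ℝ :=
  4 * sys.c₀ ^ 2 * ‖sys.Sig‖ * β₁ n p ε M D * √p * (max M 1) ^ 2

def α₃ (p : ℕ) (M D : ℝ) : ℝ := 2 * sys.c₀ ^ 2 * ‖sys.Sig‖ * β₂ n p M D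

/-- Equal to `α₃`, because `β₃ = β₂`. -/
def α₄ (p : ℕ) (M D : ℝ) : ℝ := 2 * sys.c₀ ^ 2 * ‖sys.Sig‖ * β₂ n p M D

def α₅ (p : ℕ) (γ ε M D : ℝ) : ℝ := 2 * sys.c₀ ^ 2 * ‖sys.Sig‖ * β₄ n p γ ε M D

/-- `W̃ = min {W, (1 - ρ)⁻¹}`. -/
def Wtilde (W : ℕ) : ℝ := min (W : ℝ) (1 - sys.rho)⁻¹

end

end PLOT

/-! Completing the square along the Riccati equation (`complete_square`, `exists_cost_eq`) writes
the cost of every input sequence as a constant plus `∑ ‖u_t - π*_t(x_t)‖²_Σ`, where `π*` is the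
non-causal policy evaluated at the state that `u` itself reaches. Optimality of `π*` is then
immediate, and the regret of any policy equals the sum of its squared deviations from `π*` along its
own trajectory (`regret_eq_sum`), so two trajectories never have to be compared.

For PLOT the deviation at time `t` is a sum of gains applied to prediction errors plus the
feedforward terms beyond the window. The identity `K_{i+1} A = K_i - Σ⁻¹ Bᵀ ((A - B K)ᵀ)^i Q` allows
a summation by parts after which each prediction error meets a single gain of norm at most `c₀ ρ^i`;
here `ρ` is the contraction rate of `A - B K` in the norm of `X`. The missing terms form a geometric
tail and give the `ρ^{2W}` part. Cauchy–Schwarz with weights `ρ^i` and an exchange of sums reduce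
the rest to the accumulated squared error of each `k`-step predictor.

That predictor consists of `k` interleaved least-squares learners. One update
(`IsInterleaved.error_sq_le`) bounds the squared error by the decrease of a weighted distance to the
true parameter, the change of that parameter, and an increment of `log det P`. Summed with stride
`k`, the first and the last telescope up to `k` boundary terms. The `k`-step parameters vary by at
most `k² √p max(M,1)² V_T`: one factor `k` comes from the stride, the other from expanding a product
of `k` companion matrices. Summing `k²`, `1` and `k` against `ρ^{k-1}` gives `2 W̃³`, `W̃` and
`W̃²`; the factor `W̃` from Cauchy–Schwarz raises each power by one.

Existence of `X` comes from value iteration started at zero, which is monotone and is bounded by the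
cost of a stabilizing gain. Uniqueness plays no role: the argument uses only that `X` is a positive
semidefinite solution. -/

namespace PLOT

noncomputable section

/-! ### Euclidean and operator norms on plain vectors and matrices -/

section EuclideanNorm

variable {ι κ : Type*} [Fintype ι] [Fintype κ]

/-- Euclidean norm of a plain vector. -/
abbrev l2 (v : ι → ℝ) : ℝ := ‖WithLp.toLp 2 v‖

lemma l2_nonneg (v : ι → ℝ) : 0 ≤ l2 v := norm_nonneg _

lemma l2_sq (v : ι → ℝ) : l2 v ^ 2 = v ⬝ᵥ v := by
  rw [l2, EuclideanSpace.norm_sq_eq]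
  simp [dotProduct, pow_two]

lemma l2_sq_eq_sum (v : ι → ℝ) : l2 v ^ 2 = ∑ i, v i ^ 2 := by
  rw [l2_sq]
  simp [dotProduct, pow_two]

lemma l2_add_le (v w : ι → ℝ) : l2 (v + w) ≤ l2 v + l2 w := by
  simpa [l2] using norm_add_le (WithLp.toLp 2 v) (WithLp.toLp 2 w)

lemma l2_sub_le (v w : ι → ℝ) : l2 (v - w) ≤ l2 v + l2 w := by
  simpa [l2] using norm_sub_le (WithLp.toLp 2 v) (WithLp.toLp 2 w)

lemma l2_neg (v : ι → ℝ) : l2 (-v) = l2 v := by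
  simp [l2]

lemma l2_sum_le {α : Type*} (s : Finset α) (f : α → ι → ℝ) :
    l2 (∑ a ∈ s, f a) ≤ ∑ a ∈ s, l2 (f a) := by
  classical
  induction s using Finset.induction_on with
  | empty => simp
  | insert a s ha ih =>
    rw [Finset.sum_insert ha, Finset.sum_insert ha]
    exact (l2_add_le _ _).trans (by gcongr)

lemma dotProduct_le_l2 (v w : ι → ℝ) : v ⬝ᵥ w ≤ l2 v * l2 w := by
  have h := real_inner_le_norm (WithLp.toLp 2 w) (WithLp.toLp 2 v)
  rw [EuclideanSpace.inner_toLp_toLp] at h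
  simpa [mul_comm] using h

lemma l2_mulVec_le [DecidableEq κ] (A : Matrix ι κ ℝ) (v : κ → ℝ) :
    l2 (A *ᵥ v) ≤ ‖A‖ * l2 v :=
  Matrix.l2_opNorm_mulVec A (WithLp.toLp 2 v)

lemma opNorm_le_of_l2_mulVec_le [DecidableEq κ] (A : Matrix ι κ ℝ) {c : ℝ} (hc : 0 ≤ c)
    (h : ∀ v, l2 (A *ᵥ v) ≤ c * l2 v) : ‖A‖ ≤ c := by
  rw [Matrix.l2_opNorm_def]
  exact ContinuousLinearMap.opNorm_le_bound _ hc fun v => h v.ofLp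

lemma opNorm_transpose [DecidableEq ι] [DecidableEq κ] (A : Matrix ι κ ℝ) : ‖Aᵀ‖ = ‖A‖ := by
  rw [← Matrix.conjTranspose_eq_transpose_of_trivial, Matrix.l2_opNorm_conjTranspose]

end EuclideanNorm

/-! ### Real quadratic forms and the spectrum -/

section QuadraticForm

variable {ι : Type*} [Fintype ι]

lemma dotProduct_mulVec_comm_of_isSymm {Y : Matrix ι ι ℝ} (hY : Yᵀ = Y) (v w : ι → ℝ) :
    v ⬝ᵥ (Y *ᵥ w) = w ⬝ᵥ (Y *ᵥ v) := by
  rw [← Matrix.dotProduct_transpose_mulVec, hY, dotProduct_comm]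

lemma posSemidef_iff_real {Y : Matrix ι ι ℝ} :
    Y.PosSemidef ↔ Yᵀ = Y ∧ ∀ v : ι → ℝ, 0 ≤ v ⬝ᵥ (Y *ᵥ v) := by
  rw [Matrix.posSemidef_iff_dotProduct_mulVec]
  simp [Matrix.IsHermitian, Matrix.conjTranspose_eq_transpose_of_trivial]

lemma posDef_iff_real {Y : Matrix ι ι ℝ} :
    Y.PosDef ↔ Yᵀ = Y ∧ ∀ v : ι → ℝ, v ≠ 0 → 0 < v ⬝ᵥ (Y *ᵥ v) := by
  rw [Matrix.posDef_iff_dotProduct_mulVec]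
  simp [Matrix.IsHermitian, Matrix.conjTranspose_eq_transpose_of_trivial]

variable [DecidableEq ι]

/-- Cauchy–Schwarz for the semidefinite form `Y`, applied to `v` and `Y v`, gives `‖Yv‖⁴ ≤ (vᵀYv)
((Yv)ᵀ Y (Yv)) ≤ c² ‖v‖² ‖Yv‖²`. -/
lemma opNorm_le_of_forall_dotProduct_le {Y : Matrix ι ι ℝ} (hY : Y.PosSemidef) {c : ℝ}
    (hc : 0 ≤ c) (h : ∀ v, v ⬝ᵥ (Y *ᵥ v) ≤ c * l2 v ^ 2) : ‖Y‖ ≤ c := by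
  obtain ⟨hs, h0⟩ := posSemidef_iff_real.1 hY
  refine opNorm_le_of_l2_mulVec_le _ hc fun v => ?_
  have key : (v ⬝ᵥ (Y *ᵥ (Y *ᵥ v))) ^ 2
      ≤ (v ⬝ᵥ (Y *ᵥ v)) * ((Y *ᵥ v) ⬝ᵥ (Y *ᵥ (Y *ᵥ v))) := by
    -- The form at `v + x Y v` is a nonnegative quadratic polynomial in `x`; its discriminant gives
    -- Cauchy–Schwarz.
    have hq : ∀ x : ℝ, 0 ≤ ((Y *ᵥ v) ⬝ᵥ (Y *ᵥ (Y *ᵥ v))) * (x * x)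
        + 2 * (v ⬝ᵥ (Y *ᵥ (Y *ᵥ v))) * x + v ⬝ᵥ (Y *ᵥ v) := by
      intro x
      have h1 := h0 (v + x • (Y *ᵥ v))
      have h2 := dotProduct_mulVec_comm_of_isSymm hs v (Y *ᵥ v)
      simp only [Matrix.mulVec_add, Matrix.mulVec_smul, dotProduct_add, add_dotProduct,
        smul_dotProduct, dotProduct_smul, smul_eq_mul] at h1
      rw [← h2] at h1
      linarith
    have := discrim_le_zero hq
    rw [discrim] at this
    linarith
  have h1 : v ⬝ᵥ (Y *ᵥ (Y *ᵥ v)) = l2 (Y *ᵥ v) ^ 2 := by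
    rw [dotProduct_mulVec_comm_of_isSymm hs, l2_sq]
  rw [h1] at key
  have h2 := h v
  have h3 := h (Y *ᵥ v)
  have h4 : (l2 (Y *ᵥ v) ^ 2) ^ 2 ≤ (c * l2 v ^ 2) * (c * l2 (Y *ᵥ v) ^ 2) :=
    key.trans (mul_le_mul h2 h3 (h0 _) (by positivity))
  rcases (l2_nonneg (Y *ᵥ v)).eq_or_lt with h5 | h5
  · rw [← h5]
    exact mul_nonneg hc (l2_nonneg v)
  · refine le_of_sq_le_sq ?_ (mul_nonneg hc (l2_nonneg v))
    have : 0 < l2 (Y *ᵥ v) ^ 2 := by positivity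
    nlinarith

lemma posSemidef_of_spectrum_nonneg {Y : Matrix ι ι ℝ} (hY : Y.IsHermitian)
    (h : ∀ x ∈ spectrum ℝ Y, 0 ≤ x) : Y.PosSemidef := by
  rw [hY.posSemidef_iff_eigenvalues_nonneg]
  intro i
  exact h _ (by rw [hY.spectrum_real_eq_range_eigenvalues]; exact ⟨i, rfl⟩)

lemma mul_l2_sq_le_of_le_spectrum {Y : Matrix ι ι ℝ} (hY : Y.IsHermitian) {c : ℝ}
    (h : ∀ x ∈ spectrum ℝ Y, c ≤ x) (v : ι → ℝ) : c * l2 v ^ 2 ≤ v ⬝ᵥ (Y *ᵥ v) := by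
  have hH : (Y - algebraMap ℝ (Matrix ι ι ℝ) c).IsHermitian := by
    rw [Algebra.algebraMap_eq_smul_one]
    exact hY.sub (by simp [Matrix.IsHermitian])
  have hps := posSemidef_of_spectrum_nonneg hH fun x hx => by
    have h1 := h _ (add_sub_cancel (algebraMap ℝ (Matrix ι ι ℝ) c) Y ▸
      spectrum.add_mem_add_iff.2 hx)
    linarith
  have := (posSemidef_iff_real.1 hps).2 v
  rw [Algebra.algebraMap_eq_smul_one, Matrix.sub_mulVec, dotProduct_sub, Matrix.smul_mulVec,
    Matrix.one_mulVec, dotProduct_smul, ← l2_sq, smul_eq_mul] at this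
  linarith

lemma le_mul_l2_sq_of_spectrum_le {Y : Matrix ι ι ℝ} (hY : Y.IsHermitian) {c : ℝ}
    (h : ∀ x ∈ spectrum ℝ Y, x ≤ c) (v : ι → ℝ) : v ⬝ᵥ (Y *ᵥ v) ≤ c * l2 v ^ 2 := by
  have := mul_l2_sq_le_of_le_spectrum hY.neg (c := -c) (fun x hx => by
    have := h (-x) (by rw [← neg_neg Y, ← spectrum.neg_eq]; simpa using hx)
    linarith) v
  rw [Matrix.neg_mulVec, dotProduct_neg] at this
  linarith

lemma exists_eigenvector {Y : Matrix ι ι ℝ} (hY : Y.IsHermitian) {c : ℝ}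
    (hc : c ∈ spectrum ℝ Y) : ∃ v : ι → ℝ, v ≠ 0 ∧ Y *ᵥ v = c • v := by
  rw [hY.spectrum_real_eq_range_eigenvalues] at hc
  obtain ⟨i, rfl⟩ := hc
  refine ⟨(hY.eigenvectorBasis i).ofLp, fun h => ?_, hY.mulVec_eigenvectorBasis i⟩
  have h1 := hY.eigenvectorBasis.orthonormal.1 i
  rw [show hY.eigenvectorBasis i = 0 from by ext j; exact congrFun h j] at h1
  simp at h1

lemma spectrum_nonempty_of_isHermitian [Nonempty ι] {Y : Matrix ι ι ℝ} (hY : Y.IsHermitian) :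
    (spectrum ℝ Y).Nonempty := by
  rw [hY.spectrum_real_eq_range_eigenvalues]
  exact Set.range_nonempty _

lemma det_le_pow_of_forall_dotProduct_le {Y : Matrix ι ι ℝ} (hY : Y.PosDef) {c : ℝ}
    (h : ∀ v, v ⬝ᵥ (Y *ᵥ v) ≤ c * l2 v ^ 2) : Y.det ≤ c ^ Fintype.card ι := by
  rw [hY.1.det_eq_prod_eigenvalues]
  have : ∀ i, hY.1.eigenvalues i ≤ c := fun i => by
    obtain ⟨v, hv, he⟩ := exists_eigenvector hY.1 (c := hY.1.eigenvalues i)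
      (by rw [hY.1.spectrum_real_eq_range_eigenvalues]; exact ⟨i, rfl⟩)
    have h1 := h v
    rw [he, dotProduct_smul, ← l2_sq, smul_eq_mul] at h1
    refine le_of_mul_le_mul_right h1 ?_
    rw [l2_sq]
    simpa using Matrix.dotProduct_star_self_pos_iff.2 hv
  calc _ ≤ ∏ _i : ι, c := by
        simp only [RCLike.ofReal_real_eq_id, id_eq]
        exact Finset.prod_le_prod (fun i _ => (hY.eigenvalues_pos i).le) fun i _ => this i
    _ = _ := by simp

end QuadraticForm

/-! ### Extreme eigenvalues -/

section ExtremeEigenvalues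

variable {n : ℕ} {Y Z : Matrix (Fin n) (Fin n) ℝ}

lemma lambdaMin_mul_le (hY : Y.IsHermitian) (v : Fin n → ℝ) :
    lambdaMin Y * l2 v ^ 2 ≤ v ⬝ᵥ (Y *ᵥ v) :=
  mul_l2_sq_le_of_le_spectrum hY
    (fun _ hx => csInf_le Y.finite_real_spectrum.bddBelow hx) v

lemma le_lambdaMax_mul (hY : Y.IsHermitian) (v : Fin n → ℝ) :
    v ⬝ᵥ (Y *ᵥ v) ≤ lambdaMax Y * l2 v ^ 2 :=
  le_mul_l2_sq_of_spectrum_le hY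
    (fun _ hx => le_csSup Y.finite_real_spectrum.bddAbove hx) v

lemma eigenvalue_pos_of_posDef (hY : Y.PosDef) {c : ℝ} (hc : c ∈ spectrum ℝ Y) : 0 < c := by
  rw [hY.1.spectrum_real_eq_range_eigenvalues] at hc
  obtain ⟨i, rfl⟩ := hc
  exact hY.eigenvalues_pos i

lemma lambdaMin_nonneg (hY : Y.PosDef) : 0 ≤ lambdaMin Y :=
  Real.sInf_nonneg fun _ hx => (eigenvalue_pos_of_posDef hY hx).le

lemma lambdaMin_pos (hn : 0 < n) (hY : Y.PosDef) : 0 < lambdaMin Y := by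
  have : Nonempty (Fin n) := ⟨⟨0, hn⟩⟩
  exact eigenvalue_pos_of_posDef hY
    ((spectrum_nonempty_of_isHermitian hY.1).csInf_mem Y.finite_real_spectrum)

lemma lambdaMax_nonneg (hY : Y.PosDef) : 0 ≤ lambdaMax Y :=
  Real.sSup_nonneg fun _ hx => (eigenvalue_pos_of_posDef hY hx).le

lemma exists_l2_sq_eq_one (hn : 0 < n) : ∃ v : Fin n → ℝ, l2 v ^ 2 = 1 :=
  ⟨Pi.single ⟨0, hn⟩ 1, by rw [l2_sq]; simp⟩

lemma lambdaMax_pos (hn : 0 < n) (hY : Y.PosDef) : 0 < lambdaMax Y := by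
  obtain ⟨v, hv⟩ := exists_l2_sq_eq_one hn
  have h1 := lambdaMin_mul_le hY.1 v
  have h2 := le_lambdaMax_mul hY.1 v
  have := lambdaMin_pos hn hY
  rw [hv] at h1 h2
  linarith

lemma opNorm_le_lambdaMax (hY : Y.PosDef) (hZ : Z.PosSemidef)
    (h : ∀ v, v ⬝ᵥ (Z *ᵥ v) ≤ v ⬝ᵥ (Y *ᵥ v)) : ‖Z‖ ≤ lambdaMax Y :=
  opNorm_le_of_forall_dotProduct_le hZ (lambdaMax_nonneg hY)
    fun v => (h v).trans (le_lambdaMax_mul hY.1 v)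

/-- The inverse of `Z ⪰ Y ≻ 0` has operator norm at most `1 / λ_min(Y)`. -/
lemma lambdaMin_mul_l2_inv_mulVec_le (hY : Y.PosDef) (hZ : Z.PosDef)
    (h : ∀ v, v ⬝ᵥ (Y *ᵥ v) ≤ v ⬝ᵥ (Z *ᵥ v)) (v : Fin n → ℝ) :
    lambdaMin Y * l2 (Z⁻¹ *ᵥ v) ≤ l2 v := by
  have h1 := lambdaMin_mul_le hY.1 (Z⁻¹ *ᵥ v)
  have h2 := h (Z⁻¹ *ᵥ v)
  have h3 : Z *ᵥ (Z⁻¹ *ᵥ v) = v := by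
    rw [Matrix.mulVec_mulVec, Matrix.mul_nonsing_inv _ hZ.det_pos.ne'.isUnit, Matrix.one_mulVec]
  rw [h3] at h2
  have h4 := h1.trans (h2.trans (dotProduct_le_l2 _ _))
  rcases (l2_nonneg (Z⁻¹ *ᵥ v)).eq_or_lt with h5 | h5
  · rw [← h5, mul_zero]
    exact l2_nonneg v
  · nlinarith

end ExtremeEigenvalues

/-! ### Decay of powers of a stable matrix -/

section PowerDecay

open Filter Topology

/-- Powers of an element of spectral radius less than one are eventually bounded by a
geometric sequence. -/
lemma exists_eventually_norm_pow_le {𝒜 : Type*} [NormedRing 𝒜] [NormedAlgebra ℂ 𝒜]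
    [CompleteSpace 𝒜] [Nontrivial 𝒜] (a : 𝒜) (h : ∀ μ ∈ spectrum ℂ a, ‖μ‖ < 1) :
    ∃ c : ℝ, 0 ≤ c ∧ c < 1 ∧ ∀ᶠ k : ℕ in atTop, ‖a ^ k‖ ≤ c ^ k := by
  have hr : spectralRadius ℂ a < (1 : NNReal) :=
    spectrum.spectralRadius_lt_of_forall_lt a fun μ hμ => by
      rw [← NNReal.coe_lt_coe]
      simpa using h μ hμ
  obtain ⟨c, hc1, hc2⟩ := ENNReal.lt_iff_exists_nnreal_btwn.1 hr
  refine ⟨c, c.2, by exact_mod_cast hc2, ?_⟩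
  -- Gelfand's formula: `‖a^k‖^{1/k}` tends to the spectral radius, hence eventually lies below `c`.
  filter_upwards [(spectrum.pow_nnnorm_pow_one_div_tendsto_nhds_spectralRadius a).eventually_lt_const
    hc1, eventually_gt_atTop 0] with k hk hk0
  have h1 := ENNReal.rpow_le_rpow hk.le (Nat.cast_nonneg (α := ℝ) k)
  rw [← ENNReal.rpow_mul, one_div_mul_cancel (by positivity), ENNReal.rpow_one,
    ENNReal.rpow_natCast] at h1
  exact_mod_cast h1

lemma opNorm_le_opNorm_map_ofReal {n : ℕ} (A : Matrix (Fin n) (Fin n) ℝ) :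
    ‖A‖ ≤ ‖A.map (algebraMap ℝ ℂ)‖ := by
  have key : ∀ v : Fin n → ℝ, ‖WithLp.toLp 2 (fun i => ((v i : ℝ) : ℂ))‖ = l2 v := fun v => by
    rw [l2, EuclideanSpace.norm_eq, EuclideanSpace.norm_eq]
    simp
  refine opNorm_le_of_l2_mulVec_le A (norm_nonneg _) fun v => ?_
  rw [← key, ← key]
  refine le_trans (le_of_eq ?_) (Matrix.l2_opNorm_mulVec (A.map (algebraMap ℝ ℂ))
    (WithLp.toLp 2 fun i => ((v i : ℝ) : ℂ)))
  congr 1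
  ext i
  simp [Matrix.mulVec, dotProduct]

lemma exists_sum_norm_pow_sq_le {n : ℕ} (hn : 0 < n) (A : Matrix (Fin n) (Fin n) ℝ)
    (h : ∀ μ ∈ spectrum ℂ (A.map (algebraMap ℝ ℂ)), ‖μ‖ < 1) :
    ∃ C : ℝ, ∀ k : ℕ, ∑ j ∈ Finset.range k, ‖A ^ j‖ ^ 2 ≤ C := by
  have : Nonempty (Fin n) := ⟨⟨0, hn⟩⟩
  obtain ⟨c, hc0, hc1, hc⟩ := exists_eventually_norm_pow_le _ h
  have hs : Summable fun j : ℕ => ‖A ^ j‖ ^ 2 := by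
    refine Summable.of_norm_bounded_eventually_nat
      (summable_geometric_of_lt_one hc0 hc1) ?_
    filter_upwards [hc] with k hk
    have h1 : ‖A ^ k‖ ≤ c ^ k := by
      refine (opNorm_le_opNorm_map_ofReal _).trans (le_trans (le_of_eq ?_) hk)
      rw [Matrix.map_pow]
    have h2 : c ^ k ≤ 1 := pow_le_one₀ hc0 hc1.le
    rw [Real.norm_of_nonneg (by positivity)]
    nlinarith [norm_nonneg (A ^ k)]
  exact ⟨_, fun k => hs.sum_le_tsum _ fun _ _ => by positivity⟩

end PowerDecay

/-! ### Existence of a Riccati solution by value iteration -/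

namespace LQT

open Filter Topology

variable {n m : ℕ} (sys : LQT n m)

/-- The Riccati operator. -/
def riccatiMap (P : Matrix (Fin n) (Fin n) ℝ) : Matrix (Fin n) (Fin n) ℝ :=
  sys.Q + sys.Aᵀ * P * sys.A
    - sys.Aᵀ * P * sys.B * (sys.R + sys.Bᵀ * P * sys.B)⁻¹ * (sys.Bᵀ * P * sys.A)

/-- The greedy gain for the terminal weight `P`. -/
def greedyGain (P : Matrix (Fin n) (Fin n) ℝ) : Matrix (Fin m) (Fin n) ℝ :=
  (sys.R + sys.Bᵀ * P * sys.B)⁻¹ * (sys.Bᵀ * P * sys.A)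

/-- The one-step cost of the gain `L` with terminal weight `P`. -/
def gainMap (L : Matrix (Fin m) (Fin n) ℝ) (P : Matrix (Fin n) (Fin n) ℝ) :
    Matrix (Fin n) (Fin n) ℝ :=
  sys.Q + Lᵀ * sys.R * L + (sys.A - sys.B * L)ᵀ * P * (sys.A - sys.B * L)

variable {sys}

lemma posDef_add_transpose_mul_mul {P : Matrix (Fin n) (Fin n) ℝ} (hR : sys.R.PosDef)
    (hP : P.PosSemidef) : (sys.R + sys.Bᵀ * P * sys.B).PosDef := by
  have := hP.conjTranspose_mul_mul_same sys.B
  rw [Matrix.conjTranspose_eq_transpose_of_trivial] at this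
  exact hR.add_posSemidef this

/-- Completing the square in the gain. The Riccati map is therefore the minimum of `gainMap L P`
over `L`, attained at the greedy gain; positivity, monotonicity and comparison with a fixed gain all
follow from this. -/
lemma gainMap_eq {P : Matrix (Fin n) (Fin n) ℝ} (hR : sys.R.PosDef) (hP : P.PosSemidef)
    (L : Matrix (Fin m) (Fin n) ℝ) :
    sys.gainMap L P = sys.riccatiMap P + (L - sys.greedyGain P)ᵀ
      * (sys.R + sys.Bᵀ * P * sys.B) * (L - sys.greedyGain P) := by
  have hS := posDef_add_transpose_mul_mul hR hP
  have hPs := (posSemidef_iff_real.1 hP).1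
  have hSs := (posDef_iff_real.1 hS).1
  have hSG : (sys.R + sys.Bᵀ * P * sys.B) * sys.greedyGain P = sys.Bᵀ * P * sys.A := by
    rw [greedyGain, ← Matrix.mul_assoc, Matrix.mul_nonsing_inv _ hS.det_pos.ne'.isUnit,
      Matrix.one_mul]
  have hGS : (sys.greedyGain P)ᵀ * (sys.R + sys.Bᵀ * P * sys.B) = sys.Aᵀ * P * sys.B := by
    have := congrArg Matrix.transpose hSG
    rw [Matrix.transpose_mul, hSs] at this
    rw [this]
    simp [Matrix.transpose_mul, hPs, Matrix.mul_assoc]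
  have hric : sys.riccatiMap P
      = sys.Q + sys.Aᵀ * P * sys.A - sys.Aᵀ * P * sys.B * sys.greedyGain P := by
    rw [riccatiMap, greedyGain, Matrix.mul_assoc (sys.Aᵀ * P * sys.B)]
  rw [hric, Matrix.transpose_sub, Matrix.sub_mul, hGS, Matrix.sub_mul, Matrix.mul_sub,
    Matrix.mul_sub, Matrix.mul_assoc Lᵀ, Matrix.mul_assoc Lᵀ, hSG, gainMap]
  simp only [Matrix.transpose_sub, Matrix.transpose_mul, Matrix.sub_mul, Matrix.mul_sub,
    Matrix.mul_add, Matrix.add_mul, Matrix.mul_assoc]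
  abel

lemma dotProduct_conj_mulVec {ι κ : Type*} [Fintype ι] [Fintype κ] (L : Matrix ι κ ℝ)
    (Y : Matrix ι ι ℝ) (v : κ → ℝ) :
    v ⬝ᵥ ((Lᵀ * Y * L) *ᵥ v) = (L *ᵥ v) ⬝ᵥ (Y *ᵥ (L *ᵥ v)) := by
  rw [← Matrix.mulVec_mulVec, ← Matrix.mulVec_mulVec, Matrix.dotProduct_transpose_mulVec]
  exact dotProduct_comm _ _

lemma dotProduct_gainMap_mulVec (L : Matrix (Fin m) (Fin n) ℝ) (P : Matrix (Fin n) (Fin n) ℝ)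
    (v : Fin n → ℝ) : v ⬝ᵥ (sys.gainMap L P *ᵥ v)
      = v ⬝ᵥ ((sys.Q + Lᵀ * sys.R * L) *ᵥ v)
        + ((sys.A - sys.B * L) *ᵥ v) ⬝ᵥ (P *ᵥ ((sys.A - sys.B * L) *ᵥ v)) := by
  rw [gainMap, Matrix.add_mulVec, dotProduct_add, dotProduct_conj_mulVec]

lemma riccatiMap_eq_gainMap {P : Matrix (Fin n) (Fin n) ℝ} (hR : sys.R.PosDef)
    (hP : P.PosSemidef) : sys.riccatiMap P = sys.gainMap (sys.greedyGain P) P := by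
  simp [gainMap_eq hR hP]

lemma posSemidef_riccatiMap {P : Matrix (Fin n) (Fin n) ℝ} (hQ : sys.Q.PosDef) (hR : sys.R.PosDef)
    (hP : P.PosSemidef) : (sys.riccatiMap P).PosSemidef := by
  rw [riccatiMap_eq_gainMap hR hP, gainMap]
  have h1 := hR.posSemidef.conjTranspose_mul_mul_same (sys.greedyGain P)
  have h2 := hP.conjTranspose_mul_mul_same (sys.A - sys.B * sys.greedyGain P)
  rw [Matrix.conjTranspose_eq_transpose_of_trivial] at h1 h2
  exact (hQ.posSemidef.add h1).add h2

lemma dotProduct_riccatiMap_le {P : Matrix (Fin n) (Fin n) ℝ} (hR : sys.R.PosDef)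
    (hP : P.PosSemidef) (L : Matrix (Fin m) (Fin n) ℝ) (v : Fin n → ℝ) :
    v ⬝ᵥ (sys.riccatiMap P *ᵥ v) ≤ v ⬝ᵥ (sys.gainMap L P *ᵥ v) := by
  rw [gainMap_eq hR hP, Matrix.add_mulVec, dotProduct_add, dotProduct_conj_mulVec]
  have := (posSemidef_iff_real.1 (posDef_add_transpose_mul_mul hR hP).posSemidef).2
    ((L - sys.greedyGain P) *ᵥ v)
  linarith

/-- The greedy gain for `P'` is suboptimal for `P`, and for a fixed gain the one-step cost is
monotone in the terminal weight. -/
lemma riccatiMap_mono {P P' : Matrix (Fin n) (Fin n) ℝ} (hR : sys.R.PosDef)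
    (hP : P.PosSemidef) (hP' : P'.PosSemidef) (h : ∀ v, v ⬝ᵥ (P *ᵥ v) ≤ v ⬝ᵥ (P' *ᵥ v))
    (v : Fin n → ℝ) : v ⬝ᵥ (sys.riccatiMap P *ᵥ v) ≤ v ⬝ᵥ (sys.riccatiMap P' *ᵥ v) := by
  refine (dotProduct_riccatiMap_le hR hP (sys.greedyGain P') v).trans ?_
  rw [riccatiMap_eq_gainMap hR hP', dotProduct_gainMap_mulVec, dotProduct_gainMap_mulVec]
  linarith [h ((sys.A - sys.B * sys.greedyGain P') *ᵥ v)]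

variable (sys) in
/-- Value iteration started at zero. -/
def valueIter : ℕ → Matrix (Fin n) (Fin n) ℝ
  | 0 => 0
  | k + 1 => sys.riccatiMap (valueIter k)

lemma posSemidef_valueIter (hQ : sys.Q.PosDef) (hR : sys.R.PosDef) (k : ℕ) :
    (sys.valueIter k).PosSemidef := by
  induction k with
  | zero => exact Matrix.PosSemidef.zero
  | succ k ih => exact posSemidef_riccatiMap hQ hR ih

lemma valueIter_le_succ (hQ : sys.Q.PosDef) (hR : sys.R.PosDef) (k : ℕ) (v : Fin n → ℝ) :
    v ⬝ᵥ (sys.valueIter k *ᵥ v) ≤ v ⬝ᵥ (sys.valueIter (k + 1) *ᵥ v) := by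
  induction k generalizing v with
  | zero =>
    rw [valueIter, Matrix.zero_mulVec, dotProduct_zero]
    exact (posSemidef_iff_real.1 (posSemidef_valueIter hQ hR 1)).2 v
  | succ k ih =>
    exact riccatiMap_mono hR (posSemidef_valueIter hQ hR k) (posSemidef_valueIter hQ hR (k + 1)) ih v

/-- The right side is the cost of using the gain `L` for `k` steps with zero terminal weight, which
the optimal cost cannot exceed. -/
lemma valueIter_le_sum (hQ : sys.Q.PosDef) (hR : sys.R.PosDef) (L : Matrix (Fin m) (Fin n) ℝ)
    (k : ℕ) (v : Fin n → ℝ) : v ⬝ᵥ (sys.valueIter k *ᵥ v) ≤ ∑ j ∈ Finset.range k,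
      ((sys.A - sys.B * L) ^ j *ᵥ v) ⬝ᵥ
        ((sys.Q + Lᵀ * sys.R * L) *ᵥ ((sys.A - sys.B * L) ^ j *ᵥ v)) := by
  induction k generalizing v with
  | zero => simp [valueIter]
  | succ k ih =>
    refine (dotProduct_riccatiMap_le hR (posSemidef_valueIter hQ hR k) L v).trans ?_
    rw [dotProduct_gainMap_mulVec, Finset.sum_range_succ']
    have := ih ((sys.A - sys.B * L) *ᵥ v)
    simp only [Matrix.mulVec_mulVec, ← pow_succ, pow_zero, Matrix.one_mulVec] at this ⊢
    linarith

lemma exists_valueIter_le (hn : 0 < n) (hstab : Stabilizable sys.A sys.B) (hQ : sys.Q.PosDef)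
    (hR : sys.R.PosDef) (v : Fin n → ℝ) :
    ∃ C : ℝ, ∀ k, v ⬝ᵥ (sys.valueIter k *ᵥ v) ≤ C := by
  obtain ⟨L, hL⟩ := hstab
  obtain ⟨C, hC⟩ := exists_sum_norm_pow_sq_le hn _ hL
  refine ⟨‖sys.Q + Lᵀ * sys.R * L‖ * l2 v ^ 2 * C, fun k =>
    (valueIter_le_sum hQ hR L k v).trans ?_⟩
  refine le_trans ?_ (mul_le_mul_of_nonneg_left (hC k) (by positivity))
  rw [Finset.mul_sum]
  refine Finset.sum_le_sum fun j _ => ?_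
  have h1 := l2_mulVec_le ((sys.A - sys.B * L) ^ j) v
  set w := (sys.A - sys.B * L) ^ j *ᵥ v
  calc _ ≤ l2 w * l2 ((sys.Q + Lᵀ * sys.R * L) *ᵥ w) := dotProduct_le_l2 _ _
    _ ≤ l2 w * (‖sys.Q + Lᵀ * sys.R * L‖ * l2 w) := by gcongr; exact l2_mulVec_le _ _
    _ = ‖sys.Q + Lᵀ * sys.R * L‖ * l2 w ^ 2 := by ring
    _ ≤ ‖sys.Q + Lᵀ * sys.R * L‖ * (‖(sys.A - sys.B * L) ^ j‖ * l2 v) ^ 2 := by gcongr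
    _ = _ := by ring

/-- Polarization: it turns convergence of the quadratic forms into convergence of the entries. -/
lemma apply_eq_of_isSymm {Y : Matrix (Fin n) (Fin n) ℝ} (hY : Yᵀ = Y) (i j : Fin n) :
    Y i j = ((Pi.single i 1 + Pi.single j 1) ⬝ᵥ (Y *ᵥ (Pi.single i 1 + Pi.single j 1))
      - Pi.single i 1 ⬝ᵥ (Y *ᵥ Pi.single i 1) - Pi.single j 1 ⬝ᵥ (Y *ᵥ Pi.single j 1)) / 2 := by
  have h : Y j i = Y i j := congrFun (congrFun hY i) j
  simp only [Matrix.mulVec_add, dotProduct_add, add_dotProduct, Matrix.mulVec_single_one,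
    single_dotProduct, Matrix.col_apply, one_mul, h]
  ring

lemma exists_tendsto_valueIter (hn : 0 < n) (hstab : Stabilizable sys.A sys.B)
    (hQ : sys.Q.PosDef) (hR : sys.R.PosDef) :
    ∃ P, Tendsto sys.valueIter atTop (𝓝 P) := by
  have h : ∀ v : Fin n → ℝ, ∃ c, Tendsto (fun k => v ⬝ᵥ (sys.valueIter k *ᵥ v)) atTop (𝓝 c) :=
    fun v => by
      obtain ⟨C, hC⟩ := exists_valueIter_le hn hstab hQ hR v
      exact ⟨_, tendsto_atTop_ciSup (monotone_nat_of_le_succ fun k => valueIter_le_succ hQ hR k v)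
        ⟨C, by rintro _ ⟨k, rfl⟩; exact hC k⟩⟩
  choose c hc using h
  refine ⟨Matrix.of fun i j => (c (Pi.single i 1 + Pi.single j 1) - c (Pi.single i 1)
    - c (Pi.single j 1)) / 2, ?_⟩
  refine tendsto_pi_nhds.2 fun i => tendsto_pi_nhds.2 fun j => ?_
  have := (((hc (Pi.single i 1 + Pi.single j 1)).sub (hc (Pi.single i 1))).sub
    (hc (Pi.single j 1))).div_const 2
  refine this.congr fun k => ?_
  exact (apply_eq_of_isSymm (posSemidef_iff_real.1 (posSemidef_valueIter hQ hR k)).1 i j).symm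

theorem exists_isRiccatiSolution (hn : 0 < n) (hstab : Stabilizable sys.A sys.B)
    (hQ : sys.Q.PosDef) (hR : sys.R.PosDef) : ∃ P, sys.IsRiccatiSolution P := by
  obtain ⟨P, hP⟩ := exists_tendsto_valueIter hn hstab hQ hR
  have hps : P.PosSemidef := by
    rw [posSemidef_iff_real]
    have h := fun k => posSemidef_iff_real.1 (posSemidef_valueIter hQ hR k)
    refine ⟨tendsto_nhds_unique ?_ hP, fun v => ?_⟩
    · have : Tendsto (fun k => (sys.valueIter k)ᵀ) atTop (𝓝 Pᵀ) :=
        (continuous_id.matrix_transpose.tendsto P).comp hP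
      exact this.congr fun k => (h k).1
    · have hc : Continuous fun Y : Matrix (Fin n) (Fin n) ℝ => v ⬝ᵥ (Y *ᵥ v) := by fun_prop
      exact ge_of_tendsto' ((hc.tendsto P).comp hP) fun k => (h k).2 v
  refine ⟨P, hps, ?_⟩
  -- Inversion is continuous here because `R + Bᵀ P B` is positive definite at the limit; a limit of
  -- the iteration is then a fixed point.
  have hcont : ContinuousAt sys.riccatiMap P := by
    have hinv : ContinuousAt (fun Y : Matrix (Fin n) (Fin n) ℝ =>
        (sys.R + sys.Bᵀ * Y * sys.B)⁻¹) P := by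
      refine ContinuousAt.comp (g := Inv.inv) (f := fun Y : Matrix (Fin n) (Fin n) ℝ =>
        sys.R + sys.Bᵀ * Y * sys.B) (continuousAt_matrix_inv _ ?_) (by fun_prop)
      rw [Ring.inverse_eq_inv']
      exact continuousAt_inv₀ (posDef_add_transpose_mul_mul hR hps).det_pos.ne'
    have h1 : ContinuousAt (fun Y : Matrix (Fin n) (Fin n) ℝ => sys.Aᵀ * Y * sys.B) P := by fun_prop
    have h2 : ContinuousAt (fun Y : Matrix (Fin n) (Fin n) ℝ => sys.Bᵀ * Y * sys.A) P := by fun_prop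
    have h3 : ContinuousAt (fun Y : Matrix (Fin n) (Fin n) ℝ =>
      sys.Q + sys.Aᵀ * Y * sys.A) P := by fun_prop
    have hmul : ∀ {a b c : ℕ} {f : Matrix (Fin n) (Fin n) ℝ → Matrix (Fin a) (Fin b) ℝ}
        {g : Matrix (Fin n) (Fin n) ℝ → Matrix (Fin b) (Fin c) ℝ},
        ContinuousAt f P → ContinuousAt g P → ContinuousAt (fun Y => f Y * g Y) P :=
      fun hf hg => (continuous_fst.matrix_mul continuous_snd).continuousAt.comp (hf.prodMk hg)
    exact h3.sub (hmul (hmul h1 hinv) h2)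
  exact tendsto_nhds_unique ((tendsto_add_atTop_iff_nat 1).2 hP) (hcont.tendsto.comp hP)

lemma isRiccatiSolution_X (hn : 0 < n) (hstab : Stabilizable sys.A sys.B)
    (hQ : sys.Q.PosDef) (hR : sys.R.PosDef) : sys.IsRiccatiSolution sys.X :=
  Classical.epsilon_spec (exists_isRiccatiSolution hn hstab hQ hR)

end LQT

namespace LQT

variable {n m : ℕ} {sys : LQT n m}

/-! ### Riccati identities for the closed loop -/

section ClosedLoop

lemma posDef_Sig (hX : sys.IsRiccatiSolution sys.X) (hR : sys.R.PosDef) : sys.Sig.PosDef := by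
  rw [Sig, add_comm]
  exact posDef_add_transpose_mul_mul hR hX.1

lemma greedyGain_X : sys.greedyGain sys.X = sys.K := by
  rw [greedyGain, K, Sig, add_comm]
  simp only [Matrix.mul_assoc]

lemma Sig_mul_K (hX : sys.IsRiccatiSolution sys.X) (hR : sys.R.PosDef) :
    sys.Sig * sys.K = sys.Bᵀ * sys.X * sys.A := by
  rw [K, Matrix.mul_assoc, Matrix.mul_assoc,
    Matrix.mul_nonsing_inv_cancel_left _ _ (posDef_Sig hX hR).det_pos.ne'.isUnit, Matrix.mul_assoc]

lemma X_eq_gainMap (hX : sys.IsRiccatiSolution sys.X) (hR : sys.R.PosDef) :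
    sys.X = sys.gainMap sys.K sys.X := by
  rw [← greedyGain_X, ← riccatiMap_eq_gainMap hR hX.1]
  exact hX.2

lemma transpose_X (hX : sys.IsRiccatiSolution sys.X) : sys.Xᵀ = sys.X :=
  (posSemidef_iff_real.1 hX.1).1

lemma transpose_R (hR : sys.R.PosDef) : sys.Rᵀ = sys.R :=
  (posDef_iff_real.1 hR).1

/-- `Bᵀ X (A - B K) = R K`. -/
lemma transpose_B_mul_X_mul_closedLoop (hX : sys.IsRiccatiSolution sys.X) (hR : sys.R.PosDef) :
    sys.Bᵀ * sys.X * (sys.A - sys.B * sys.K) = sys.R * sys.K := by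
  rw [Matrix.mul_sub, ← Sig_mul_K hX hR, ← Matrix.mul_assoc, ← Matrix.sub_mul, Sig,
    add_sub_cancel_left]

/-- `(A - B K)ᵀ X A = X - Q`. -/
lemma transpose_closedLoop_mul_X_mul_A (hX : sys.IsRiccatiSolution sys.X) (hR : sys.R.PosDef) :
    (sys.A - sys.B * sys.K)ᵀ * sys.X * sys.A = sys.X - sys.Q := by
  have h1 : (sys.A - sys.B * sys.K)ᵀ * sys.X * sys.B = sys.Kᵀ * sys.R := by
    have := congrArg Matrix.transpose (transpose_B_mul_X_mul_closedLoop hX hR)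
    simpa [Matrix.transpose_mul, transpose_X hX, transpose_R hR, Matrix.mul_assoc] using this
  have h2 := X_eq_gainMap hX hR
  rw [gainMap, Matrix.mul_sub, ← Matrix.mul_assoc, h1] at h2
  rw [eq_sub_iff_add_eq]
  nth_rw 2 [h2]
  abel

/-- The Riccati equation in Lyapunov form. It yields `X ⪰ Q` and the contraction of `A - B K` in the
norm of `X`. -/
lemma dotProduct_X_mulVec (hX : sys.IsRiccatiSolution sys.X) (hR : sys.R.PosDef)
    (e : Fin n → ℝ) : e ⬝ᵥ (sys.X *ᵥ e) = e ⬝ᵥ (sys.Q *ᵥ e)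
      + (sys.K *ᵥ e) ⬝ᵥ (sys.R *ᵥ (sys.K *ᵥ e))
      + ((sys.A - sys.B * sys.K) *ᵥ e) ⬝ᵥ (sys.X *ᵥ ((sys.A - sys.B * sys.K) *ᵥ e)) := by
  conv_lhs => rw [X_eq_gainMap hX hR, dotProduct_gainMap_mulVec, Matrix.add_mulVec, dotProduct_add,
    dotProduct_conj_mulVec]

lemma posDef_X (hX : sys.IsRiccatiSolution sys.X) (hQ : sys.Q.PosDef) (hR : sys.R.PosDef) :
    sys.X.PosDef := by
  rw [posDef_iff_real]
  refine ⟨transpose_X hX, fun v hv => ?_⟩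
  rw [dotProduct_X_mulVec hX hR]
  have h1 := (posDef_iff_real.1 hQ).2 v hv
  have h2 := (posSemidef_iff_real.1 hR.posSemidef).2 (sys.K *ᵥ v)
  have h3 := (posSemidef_iff_real.1 hX.1).2 ((sys.A - sys.B * sys.K) *ᵥ v)
  linarith

lemma Q_le_X (hX : sys.IsRiccatiSolution sys.X) (hR : sys.R.PosDef) (v : Fin n → ℝ) :
    v ⬝ᵥ (sys.Q *ᵥ v) ≤ v ⬝ᵥ (sys.X *ᵥ v) := by
  rw [dotProduct_X_mulVec hX hR]
  have h2 := (posSemidef_iff_real.1 hR.posSemidef).2 (sys.K *ᵥ v)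
  have h3 := (posSemidef_iff_real.1 hX.1).2 ((sys.A - sys.B * sys.K) *ᵥ v)
  linarith

end ClosedLoop

/-! ### The cost as a constant plus squared deviations -/

section CompletingSquares

/-- The feedforward vector `∑_{i=t}^{T-1} ((A - B K)ᵀ)^{i-t} X d_i`. -/
def feedforward (sys : LQT n m) (d : ℕ → Fin n → ℝ) (T t : ℕ) : Fin n → ℝ :=
  ∑ i ∈ Finset.Ico t T, ((sys.A - sys.B * sys.K)ᵀ) ^ (i - t) *ᵥ (sys.X *ᵥ d i)

lemma feedforward_self (d : ℕ → Fin n → ℝ) (T : ℕ) : sys.feedforward d T T = 0 := by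
  simp [feedforward]

lemma feedforward_of_lt (d : ℕ → Fin n → ℝ) {T t : ℕ} (ht : t < T) :
    sys.feedforward d T t = sys.X *ᵥ d t
      + (sys.A - sys.B * sys.K)ᵀ *ᵥ sys.feedforward d T (t + 1) := by
  rw [feedforward, Finset.sum_eq_sum_Ico_succ_bot ht, feedforward, Matrix.mulVec_sum]
  congr 1
  · simp
  · refine Finset.sum_congr rfl fun i hi => ?_
    rw [Finset.mem_Ico] at hi
    rw [show i - t = i - (t + 1) + 1 by omega, pow_succ', ← Matrix.mulVec_mulVec]

/-- One step of dynamic programming with a value function that has a linear term `2 eᵀ h`. The input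
enters the right side only through the `Σ`-square, and the last group depends on neither `e` nor
`u`. -/
lemma complete_square (hX : sys.IsRiccatiSolution sys.X) (hR : sys.R.PosDef)
    (d h e : Fin n → ℝ) (u σ : Fin m → ℝ) (hσ : σ = sys.Sig⁻¹ *ᵥ (sys.Bᵀ *ᵥ (sys.X *ᵥ d + h))) :
    e ⬝ᵥ (sys.Q *ᵥ e) + u ⬝ᵥ (sys.R *ᵥ u)
      + ((sys.A *ᵥ e + sys.B *ᵥ u + d) ⬝ᵥ (sys.X *ᵥ (sys.A *ᵥ e + sys.B *ᵥ u + d))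
        + 2 * ((sys.A *ᵥ e + sys.B *ᵥ u + d) ⬝ᵥ h))
    = e ⬝ᵥ (sys.X *ᵥ e) + 2 * (e ⬝ᵥ ((sys.A - sys.B * sys.K)ᵀ *ᵥ (sys.X *ᵥ d + h)))
      + (u + sys.K *ᵥ e + σ) ⬝ᵥ (sys.Sig *ᵥ (u + sys.K *ᵥ e + σ))
      + (σ ⬝ᵥ (sys.R *ᵥ σ) + (d - sys.B *ᵥ σ) ⬝ᵥ (sys.X *ᵥ (d - sys.B *ᵥ σ))
        + 2 * ((d - sys.B *ᵥ σ) ⬝ᵥ h)) := by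
  have hXs := dotProduct_mulVec_comm_of_isSymm (transpose_X hX)
  have hRs := dotProduct_mulVec_comm_of_isSymm (transpose_R hR)
  -- `w` is the deviation of `u` from the minimizer `-K e - σ`.
  obtain ⟨w, rfl⟩ : ∃ w, u = w - sys.K *ᵥ e - σ := ⟨u + sys.K *ᵥ e + σ, by abel⟩
  have hw : w - sys.K *ᵥ e - σ + sys.K *ᵥ e + σ = w := by abel
  have he : sys.A *ᵥ e + sys.B *ᵥ (w - sys.K *ᵥ e - σ) + d
      = (sys.A - sys.B * sys.K) *ᵥ e + sys.B *ᵥ w + (d - sys.B *ᵥ σ) := by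
    rw [Matrix.mulVec_sub, Matrix.mulVec_sub, Matrix.sub_mulVec, Matrix.mulVec_mulVec]
    abel
  have hB : ∀ (w' : Fin m → ℝ) (v : Fin n → ℝ), (sys.B *ᵥ w') ⬝ᵥ v = w' ⬝ᵥ (sys.Bᵀ *ᵥ v) :=
    fun w' v => by rw [Matrix.dotProduct_transpose_mulVec, dotProduct_comm]
  have hRK : ∀ w' : Fin m → ℝ, (sys.B *ᵥ w') ⬝ᵥ (sys.X *ᵥ ((sys.A - sys.B * sys.K) *ᵥ e))
      = w' ⬝ᵥ (sys.R *ᵥ (sys.K *ᵥ e)) := fun w' => by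
    rw [hB, Matrix.mulVec_mulVec, Matrix.mulVec_mulVec, Matrix.mulVec_mulVec,
      transpose_B_mul_X_mul_closedLoop hX hR]
  have hSσ : sys.Sig *ᵥ σ = sys.Bᵀ *ᵥ (sys.X *ᵥ d + h) := by
    rw [hσ, Matrix.mulVec_mulVec, Matrix.mul_nonsing_inv _ (posDef_Sig hX hR).det_pos.ne'.isUnit,
      Matrix.one_mulVec]
  have hS : ∀ w₁ w₂ : Fin m → ℝ, w₁ ⬝ᵥ (sys.Sig *ᵥ w₂)
      = w₁ ⬝ᵥ (sys.R *ᵥ w₂) + (sys.B *ᵥ w₁) ⬝ᵥ (sys.X *ᵥ (sys.B *ᵥ w₂)) := fun w₁ w₂ => by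
    rw [Sig, Matrix.add_mulVec, dotProduct_add, hB, Matrix.mulVec_mulVec, Matrix.mulVec_mulVec,
      add_comm]
  have F4 := hS w σ
  rw [hSσ, ← hB, dotProduct_add] at F4
  have F6 : e ⬝ᵥ ((sys.A - sys.B * sys.K)ᵀ *ᵥ (sys.X *ᵥ d + h))
      = ((sys.A - sys.B * sys.K) *ᵥ e) ⬝ᵥ (sys.X *ᵥ d) + ((sys.A - sys.B * sys.K) *ᵥ e) ⬝ᵥ h := by
    rw [Matrix.dotProduct_transpose_mulVec, dotProduct_comm, dotProduct_add]
  rw [hw, he, hS w w, F6, dotProduct_X_mulVec hX hR e]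
  have F2 := hRK w
  have F3 := hRK σ
  generalize (sys.A - sys.B * sys.K) *ᵥ e = a at *
  generalize sys.K *ᵥ e = k at *
  generalize sys.B *ᵥ w = b at *
  generalize sys.B *ᵥ σ = s at *
  simp only [Matrix.mulVec_add, Matrix.mulVec_sub, dotProduct_add, dotProduct_sub, add_dotProduct,
    sub_dotProduct]
  linarith [hXs a b, hXs a d, hXs a s, hXs b d, hXs b s, hXs d s, hRs w k, hRs w σ, hRs k σ]

/-- `A r_i - r_{i+1}`. -/
def drift (sys : LQT n m) (r : ℤ → Fin n → ℝ) (i : ℕ) : Fin n → ℝ :=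
  sys.A *ᵥ r i - r (i + 1)

lemma optimalPolicy_eq (r : ℤ → Fin n → ℝ) (T t : ℕ) (x : Fin n → ℝ) :
    sys.optimalPolicy r T t x = -(sys.K *ᵥ (x - r t))
      - sys.Sig⁻¹ *ᵥ (sys.Bᵀ *ᵥ sys.feedforward (sys.drift r) T t) := by
  rw [optimalPolicy, feedforward, Matrix.mulVec_sum, Matrix.mulVec_sum]
  simp only [Kff, drift, Matrix.mulVec_mulVec, Matrix.mul_assoc]

/-- The cost of any input sequence is a constant plus the squared deviation from the optimal
policy along its own trajectory. -/
lemma exists_cost_eq (hX : sys.IsRiccatiSolution sys.X) (hR : sys.R.PosDef)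
    (r : ℤ → Fin n → ℝ) (T : ℕ) (x₀ : Fin n → ℝ) :
    ∃ c : ℝ, ∀ u, sys.cost r T x₀ u = c + ∑ t ∈ Finset.range T,
      qform sys.Sig (u t - sys.optimalPolicy r T t (sys.state x₀ u t)) := by
  set g := sys.feedforward (sys.drift r) T with hg
  set M := sys.A - sys.B * sys.K with hM
  set σ : ℕ → Fin m → ℝ := fun t => sys.Sig⁻¹ *ᵥ (sys.Bᵀ *ᵥ g t) with hσ
  set κ : ℕ → ℝ := fun t => σ t ⬝ᵥ (sys.R *ᵥ σ t)
    + (sys.drift r t - sys.B *ᵥ σ t) ⬝ᵥ (sys.X *ᵥ (sys.drift r t - sys.B *ᵥ σ t))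
        + 2 * ((sys.drift r t - sys.B *ᵥ σ t) ⬝ᵥ (Mᵀ *ᵥ g (t + 1))) with hκ
  -- The value function of the tracking error up to an additive constant, the constants being
  -- collected in `κ`. As `g T = 0`, `V T` is the terminal cost.
  set V : ℕ → (Fin n → ℝ) → ℝ := fun t e => e ⬝ᵥ (sys.X *ᵥ e) + 2 * (e ⬝ᵥ (Mᵀ *ᵥ g t)) with hV
  refine ⟨V 0 (x₀ - r 0) + ∑ t ∈ Finset.range T, κ t, fun u => ?_⟩
  have step : ∀ t ∈ Finset.range T,
      qform sys.Q (sys.state x₀ u t - r t) + qform sys.R (u t)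
        = (V t (sys.state x₀ u t - r t) - V (t + 1) (sys.state x₀ u (t + 1) - r (t + 1 : ℕ)))
          + (κ t + qform sys.Sig (u t - sys.optimalPolicy r T t (sys.state x₀ u t))) := by
    intro t ht
    have hgt : g t = sys.X *ᵥ sys.drift r t + Mᵀ *ᵥ g (t + 1) :=
      feedforward_of_lt _ (Finset.mem_range.1 ht)
    have h1 := complete_square hX hR (sys.drift r t) (Mᵀ *ᵥ g (t + 1)) (sys.state x₀ u t - r t)
      (u t) (σ t) (by rw [← hgt])
    have h2 : sys.A *ᵥ (sys.state x₀ u t - r t) + sys.B *ᵥ u t + sys.drift r t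
        = sys.state x₀ u (t + 1) - r (t + 1 : ℕ) := by
      rw [state, drift, Matrix.mulVec_sub]
      push_cast
      abel
    have h3 : u t - sys.optimalPolicy r T t (sys.state x₀ u t)
        = u t + sys.K *ᵥ (sys.state x₀ u t - r t) + σ t := by
      rw [optimalPolicy_eq]
      abel
    rw [h2, ← hgt] at h1
    rw [h3]
    simp only [hV, hκ, qform]
    linarith
  have hT : V T (sys.state x₀ u T - r T) = qform sys.X (sys.state x₀ u T - r T) := by
    simp [hV, hg, feedforward_self, qform]
  have h0 : V 0 (sys.state x₀ u 0 - r (0 : ℕ)) = V 0 (x₀ - r 0) := rfl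
  rw [cost, Finset.sum_congr rfl step, Finset.sum_add_distrib, Finset.sum_add_distrib,
    Finset.sum_range_sub' (fun t => V t (sys.state x₀ u t - r t)), hT, h0]
  ring

lemma state_inputs (x₀ : Fin n → ℝ) (π : ℕ → (Fin n → ℝ) → Fin m → ℝ) (t : ℕ) :
    sys.state x₀ (sys.inputs x₀ π) t = sys.closedLoop x₀ π t := by
  induction t with
  | zero => rfl
  | succ t ih => rw [state, closedLoop, ih, inputs]

lemma qform_Sig_nonneg (hX : sys.IsRiccatiSolution sys.X) (hR : sys.R.PosDef) (v : Fin m → ℝ) :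
    0 ≤ qform sys.Sig v :=
  (posSemidef_iff_real.1 (posDef_Sig hX hR).posSemidef).2 v

theorem cost_optimalPolicy_le (hX : sys.IsRiccatiSolution sys.X) (hR : sys.R.PosDef)
    (r : ℤ → Fin n → ℝ) (T : ℕ) (x₀ : Fin n → ℝ) (u : ℕ → Fin m → ℝ) :
    sys.cost r T x₀ (sys.inputs x₀ (sys.optimalPolicy r T)) ≤ sys.cost r T x₀ u := by
  obtain ⟨c, hc⟩ := exists_cost_eq hX hR r T x₀
  rw [hc, hc]
  simp only [state_inputs]
  have : ∀ t, sys.inputs x₀ (sys.optimalPolicy r T) t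
      - sys.optimalPolicy r T t (sys.closedLoop x₀ (sys.optimalPolicy r T) t) = 0 :=
    fun t => sub_self _
  simp only [this]
  refine add_le_add_right (Finset.sum_le_sum fun t _ => ?_) _
  simpa [qform] using qform_Sig_nonneg hX hR (u t - sys.optimalPolicy r T t (sys.state x₀ u t))

theorem regret_eq_sum (hX : sys.IsRiccatiSolution sys.X) (hR : sys.R.PosDef)
    (r : ℤ → Fin n → ℝ) (T : ℕ) (x₀ : Fin n → ℝ) (π : ℕ → (Fin n → ℝ) → Fin m → ℝ) :
    sys.regret r T x₀ π = ∑ t ∈ Finset.range T, qform sys.Sig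
      (π t (sys.closedLoop x₀ π t) - sys.optimalPolicy r T t (sys.closedLoop x₀ π t)) := by
  obtain ⟨c, hc⟩ := exists_cost_eq hX hR r T x₀
  rw [regret, hc, hc]
  simp [state_inputs, inputs, qform]

end CompletingSquares

/-! ### Contraction rate and gain bounds -/

section GainBounds

lemma lambdaMin_Q_le_lambdaMax_X (hn : 0 < n) (hX : sys.IsRiccatiSolution sys.X)
    (hQ : sys.Q.PosDef) (hR : sys.R.PosDef) : lambdaMin sys.Q ≤ lambdaMax sys.X := by
  obtain ⟨v, hv⟩ := exists_l2_sq_eq_one hn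
  have h1 := lambdaMin_mul_le hQ.1 v
  have h2 := Q_le_X hX hR v
  have h3 := le_lambdaMax_mul (posDef_X hX hQ hR).1 v
  rw [hv] at h1 h3
  linarith

lemma rho_nonneg : 0 ≤ sys.rho := Real.sqrt_nonneg _

/-- Since `Q ⪯ X`, the radicand is nonnegative and the real square root is not truncated to zero. -/
lemma rho_sq (hn : 0 < n) (hX : sys.IsRiccatiSolution sys.X)
    (hQ : sys.Q.PosDef) (hR : sys.R.PosDef) :
    sys.rho ^ 2 = 1 - lambdaMin sys.Q / lambdaMax sys.X := by
  rw [rho, Real.sq_sqrt]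
  have := (div_le_one (lambdaMax_pos hn (posDef_X hX hQ hR))).2
    (lambdaMin_Q_le_lambdaMax_X hn hX hQ hR)
  linarith

lemma rho_lt_one (hn : 0 < n) (hX : sys.IsRiccatiSolution sys.X)
    (hQ : sys.Q.PosDef) (hR : sys.R.PosDef) : sys.rho < 1 := by
  have h1 := rho_sq hn hX hQ hR
  have h2 : 0 < lambdaMin sys.Q / lambdaMax sys.X :=
    div_pos (lambdaMin_pos hn hQ) (lambdaMax_pos hn (posDef_X hX hQ hR))
  nlinarith [rho_nonneg (sys := sys)]

/-- In the Lyapunov identity the `R`-term is dropped and `Q ⪰ (λ_min(Q) / λ_max(X)) X` is used. -/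
lemma dotProduct_X_closedLoop_le (hn : 0 < n) (hX : sys.IsRiccatiSolution sys.X)
    (hQ : sys.Q.PosDef) (hR : sys.R.PosDef) (v : Fin n → ℝ) :
    ((sys.A - sys.B * sys.K) *ᵥ v) ⬝ᵥ (sys.X *ᵥ ((sys.A - sys.B * sys.K) *ᵥ v))
      ≤ sys.rho ^ 2 * (v ⬝ᵥ (sys.X *ᵥ v)) := by
  have hXd := posDef_X hX hQ hR
  have h1 := dotProduct_X_mulVec hX hR v
  have h2 := (posSemidef_iff_real.1 hR.posSemidef).2 (sys.K *ᵥ v)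
  have h3 := lambdaMin_mul_le hQ.1 v
  have h4 := le_lambdaMax_mul hXd.1 v
  have h5 := lambdaMax_pos hn hXd
  have h6 := lambdaMin_pos hn hQ
  have h7 : lambdaMin sys.Q / lambdaMax sys.X * (v ⬝ᵥ (sys.X *ᵥ v)) ≤ lambdaMin sys.Q * l2 v ^ 2 := by
    calc _ ≤ lambdaMin sys.Q / lambdaMax sys.X * (lambdaMax sys.X * l2 v ^ 2) := by gcongr
      _ = _ := by field_simp
  rw [rho_sq hn hX hQ hR]
  linarith

/-- The square root is the price of passing from the norm of `X` to the Euclidean norm and back. -/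
lemma opNorm_closedLoop_pow_le (hn : 0 < n) (hX : sys.IsRiccatiSolution sys.X)
    (hQ : sys.Q.PosDef) (hR : sys.R.PosDef) (i : ℕ) :
    ‖(sys.A - sys.B * sys.K) ^ i‖
      ≤ sys.rho ^ i * √(lambdaMax sys.X / lambdaMin sys.X) := by
  have hXd := posDef_X hX hQ hR
  have hmax := lambdaMax_pos hn hXd
  have hmin := lambdaMin_pos hn hXd
  have hρ := rho_nonneg (sys := sys)
  refine opNorm_le_of_l2_mulVec_le _ (by positivity) fun v => ?_
  have key : ∀ i : ℕ, ((sys.A - sys.B * sys.K) ^ i *ᵥ v)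
      ⬝ᵥ (sys.X *ᵥ ((sys.A - sys.B * sys.K) ^ i *ᵥ v))
      ≤ (sys.rho ^ i) ^ 2 * (v ⬝ᵥ (sys.X *ᵥ v)) := fun i => by
    induction i with
    | zero => simp
    | succ i ih =>
      have := dotProduct_X_closedLoop_le hn hX hQ hR ((sys.A - sys.B * sys.K) ^ i *ᵥ v)
      rw [Matrix.mulVec_mulVec, ← pow_succ'] at this
      refine this.trans ?_
      calc _ ≤ sys.rho ^ 2 * ((sys.rho ^ i) ^ 2 * (v ⬝ᵥ (sys.X *ᵥ v))) := by gcongr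
        _ = _ := by ring
  have h1 := lambdaMin_mul_le hXd.1 ((sys.A - sys.B * sys.K) ^ i *ᵥ v)
  have h2 := le_lambdaMax_mul hXd.1 v
  refine le_of_sq_le_sq ?_ (by positivity)
  rw [mul_pow, mul_pow, Real.sq_sqrt (by positivity)]
  have h3 : lambdaMin sys.X * l2 ((sys.A - sys.B * sys.K) ^ i *ᵥ v) ^ 2
      ≤ (sys.rho ^ i) ^ 2 * (lambdaMax sys.X * l2 v ^ 2) :=
    (h1.trans (key i)).trans (by gcongr)
  calc _ = lambdaMin sys.X * l2 ((sys.A - sys.B * sys.K) ^ i *ᵥ v) ^ 2 / lambdaMin sys.X := by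
        field_simp
    _ ≤ (sys.rho ^ i) ^ 2 * (lambdaMax sys.X * l2 v ^ 2) / lambdaMin sys.X := by gcongr
    _ = _ := by ring

lemma opNorm_Sig_inv_le (hX : sys.IsRiccatiSolution sys.X) (hR : sys.R.PosDef) :
    ‖sys.Sig⁻¹‖ ≤ (lambdaMin sys.R)⁻¹ := by
  -- Without inputs the spectrum of `R` is empty and `lambdaMin` cannot be shown positive; the
  -- matrix `Σ⁻¹` is then zero.
  rcases Nat.eq_zero_or_pos m with rfl | hm
  · rw [Subsingleton.elim sys.Sig⁻¹ 0, norm_zero]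
    exact inv_nonneg.2 (lambdaMin_nonneg hR)
  have hpos := lambdaMin_pos hm hR
  refine opNorm_le_of_l2_mulVec_le _ (by positivity) fun v => ?_
  have h := lambdaMin_mul_l2_inv_mulVec_le hR (posDef_Sig hX hR) (fun v => by
    rw [Sig, Matrix.add_mulVec, dotProduct_add, dotProduct_conj_mulVec]
    linarith [(posSemidef_iff_real.1 hX.1).2 (sys.B *ᵥ v)]) v
  rw [inv_mul_eq_div, le_div_iff₀ hpos, mul_comm]
  exact h

lemma c₀_nonneg (hX : sys.IsRiccatiSolution sys.X) (hQ : sys.Q.PosDef) (hR : sys.R.PosDef) :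
    0 ≤ sys.c₀ :=
  mul_nonneg (div_nonneg (mul_nonneg (norm_nonneg _) (lambdaMax_nonneg (posDef_X hX hQ hR)))
    (lambdaMin_nonneg hR)) (Real.sqrt_nonneg _)

/-- The feedforward gain with a weight `Y` in place of `X`. -/
lemma opNorm_gain_le (hn : 0 < n) (hX : sys.IsRiccatiSolution sys.X)
    (hQ : sys.Q.PosDef) (hR : sys.R.PosDef) {Y : Matrix (Fin n) (Fin n) ℝ}
    (hY : ‖Y‖ ≤ lambdaMax sys.X) (i : ℕ) :
    ‖sys.Sig⁻¹ * sys.Bᵀ * ((sys.A - sys.B * sys.K)ᵀ) ^ i * Y‖ ≤ sys.c₀ * sys.rho ^ i := by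
  have h1 := opNorm_Sig_inv_le hX hR
  have h2 : ‖((sys.A - sys.B * sys.K)ᵀ) ^ i‖
      ≤ sys.rho ^ i * √(lambdaMax sys.X / lambdaMin sys.X) := by
    rw [← Matrix.transpose_pow, opNorm_transpose]
    exact opNorm_closedLoop_pow_le hn hX hQ hR i
  calc _ ≤ ‖sys.Sig⁻¹‖ * ‖sys.Bᵀ‖ * ‖((sys.A - sys.B * sys.K)ᵀ) ^ i‖ * ‖Y‖ := by
        refine (Matrix.l2_opNorm_mul _ _).trans ?_
        gcongr
        refine (Matrix.l2_opNorm_mul _ _).trans ?_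
        gcongr
        exact Matrix.l2_opNorm_mul _ _
    _ ≤ (lambdaMin sys.R)⁻¹ * ‖sys.B‖
          * (sys.rho ^ i * √(lambdaMax sys.X / lambdaMin sys.X)) * lambdaMax sys.X := by
        have := lambdaMin_nonneg hR
        have := rho_nonneg (sys := sys)
        rw [opNorm_transpose]
        gcongr
    _ = _ := by
        rw [c₀]
        ring

lemma opNorm_Kff_le (hn : 0 < n) (hX : sys.IsRiccatiSolution sys.X)
    (hQ : sys.Q.PosDef) (hR : sys.R.PosDef) (i : ℕ) : ‖sys.Kff i‖ ≤ sys.c₀ * sys.rho ^ i :=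
  opNorm_gain_le hn hX hQ hR
    (opNorm_le_lambdaMax (posDef_X hX hQ hR) hX.1 fun _ => le_rfl) i

/-- `K_i - K_{i+1} A`, the gain that multiplies the prediction error at step `i + 1`. -/
def errorGain (sys : LQT n m) (i : ℕ) : Matrix (Fin m) (Fin n) ℝ :=
  sys.Sig⁻¹ * sys.Bᵀ * ((sys.A - sys.B * sys.K)ᵀ) ^ i * sys.Q

/-- As `Q ⪯ X`, the weight `Q` obeys the same norm bound as `X`, so the constant is that of `Kff`.
-/
lemma opNorm_errorGain_le (hn : 0 < n) (hX : sys.IsRiccatiSolution sys.X)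
    (hQ : sys.Q.PosDef) (hR : sys.R.PosDef) (i : ℕ) : ‖sys.errorGain i‖ ≤ sys.c₀ * sys.rho ^ i :=
  opNorm_gain_le hn hX hQ hR
    (opNorm_le_lambdaMax (posDef_X hX hQ hR) hQ.posSemidef (Q_le_X hX hR)) i

lemma Kff_succ_mul_A (hX : sys.IsRiccatiSolution sys.X) (hR : sys.R.PosDef) (i : ℕ) :
    sys.Kff (i + 1) * sys.A = sys.Kff i - sys.errorGain i := by
  rw [Kff, Kff, errorGain, ← Matrix.mul_sub, ← transpose_closedLoop_mul_X_mul_A hX hR, pow_succ]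
  simp only [Matrix.mul_assoc]

/-- Summation by parts: `e (i + 1)` occurs with `-K_i` and with `K_{i+1} A`, which combine to one
gain; only the last error keeps its full `K_N`. This keeps the factor `‖A‖ + 1` out of the
prediction part of the bound. -/
lemma sum_Kff_mulVec_error (hX : sys.IsRiccatiSolution sys.X) (hR : sys.R.PosDef)
    (e : ℕ → Fin n → ℝ) (h0 : e 0 = 0) (N : ℕ) :
    ∑ i ∈ Finset.range (N + 1), sys.Kff i *ᵥ (sys.A *ᵥ e i - e (i + 1))
      = -(∑ i ∈ Finset.range N, sys.errorGain i *ᵥ e (i + 1)) - sys.Kff N *ᵥ e (N + 1) := by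
  induction N with
  | zero => simp [h0, Matrix.mulVec_neg]
  | succ N ih =>
    rw [Finset.sum_range_succ, ih, Finset.sum_range_succ _ N, Matrix.mulVec_sub,
      Matrix.mulVec_mulVec, Kff_succ_mul_A hX hR, Matrix.sub_mulVec]
    abel

lemma l2_sum_Kff_mulVec_error_le (hn : 0 < n) (hX : sys.IsRiccatiSolution sys.X)
    (hQ : sys.Q.PosDef) (hR : sys.R.PosDef) (e : ℕ → Fin n → ℝ) (h0 : e 0 = 0) (N : ℕ) :
    l2 (∑ i ∈ Finset.range N, sys.Kff i *ᵥ (sys.A *ᵥ e i - e (i + 1)))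
      ≤ sys.c₀ * ∑ i ∈ Finset.range N, sys.rho ^ i * l2 (e (i + 1)) := by
  cases N with
  | zero => simp
  | succ N =>
    rw [sum_Kff_mulVec_error hX hR e h0, Finset.sum_range_succ, mul_add]
    refine (l2_sub_le _ _).trans (add_le_add ?_ ?_)
    · rw [l2_neg, Finset.mul_sum]
      refine (l2_sum_le _ _).trans (Finset.sum_le_sum fun i _ => ?_)
      rw [← mul_assoc]
      exact (l2_mulVec_le _ _).trans
        (mul_le_mul_of_nonneg_right (opNorm_errorGain_le hn hX hQ hR i) (l2_nonneg _))
    · rw [← mul_assoc]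
      exact (l2_mulVec_le _ _).trans
        (mul_le_mul_of_nonneg_right (opNorm_Kff_le hn hX hQ hR N) (l2_nonneg _))

lemma l2_sum_Kff_mulVec_drift_le (hn : 0 < n) (hX : sys.IsRiccatiSolution sys.X)
    (hQ : sys.Q.PosDef) (hR : sys.R.PosDef) {r : ℤ → Fin n → ℝ} {D : ℝ} {t T W : ℕ}
    (hr : ∀ t : ℕ, t ≤ T → l2 (r t) ≤ D) :
    l2 (∑ i ∈ Finset.Ico W (T - t), sys.Kff i *ᵥ sys.drift r (t + i))
      ≤ sys.c₀ * ((‖sys.A‖ + 1) * D * (sys.rho ^ W / (1 - sys.rho))) := by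
  have hD : 0 ≤ D := (l2_nonneg _).trans (hr 0 (Nat.zero_le _))
  have hc := c₀_nonneg hX hQ hR
  have hρ := rho_nonneg (sys := sys)
  refine (l2_sum_le _ _).trans ?_
  have h1 : ∀ i ∈ Finset.Ico W (T - t), l2 (sys.Kff i *ᵥ sys.drift r (t + i))
      ≤ sys.c₀ * ((‖sys.A‖ + 1) * D) * sys.rho ^ i := fun i hi => by
    rw [Finset.mem_Ico] at hi
    have h2 : l2 (sys.drift r (t + i)) ≤ (‖sys.A‖ + 1) * D := by
      have h3 := hr (t + i) (by omega)
      have h4 := hr (t + i + 1) (by omega)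
      push_cast at h3 h4
      rw [drift]
      push_cast
      calc _ ≤ ‖sys.A‖ * l2 (r (t + i)) + l2 (r (t + i + 1)) :=
            (l2_sub_le _ _).trans (by gcongr; exact l2_mulVec_le _ _)
        _ ≤ ‖sys.A‖ * D + D := by gcongr
        _ = _ := by ring
    calc _ ≤ ‖sys.Kff i‖ * l2 (sys.drift r (t + i)) := l2_mulVec_le _ _
      _ ≤ (sys.c₀ * sys.rho ^ i) * ((‖sys.A‖ + 1) * D) :=
          mul_le_mul (opNorm_Kff_le hn hX hQ hR i) h2 (l2_nonneg _) (by positivity)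
      _ = _ := by ring
  refine (Finset.sum_le_sum h1).trans ?_
  rw [← Finset.mul_sum, ← mul_assoc sys.c₀ ((‖sys.A‖ + 1) * D)]
  exact mul_le_mul_of_nonneg_left (geom_sum_Ico_le_of_lt_one hρ (rho_lt_one hn hX hQ hR))
    (by positivity)

end GainBounds

/-! ### Deviation of PLOT from the optimal policy -/

section PolicyDeviation

variable {p : ℕ} {γ ε M : ℝ} {r : ℤ → Fin n → ℝ}
  {Sinit : ℕ → ℕ → Matrix (Fin n) (Fin p × Fin n) ℝ}

/-- The feedback terms cancel. What remains is the effect of prediction errors inside the window and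
the feedforward terms beyond it, the latter an empty sum near the end of the horizon. -/
lemma plot_sub_optimalPolicy (T W t : ℕ) (x : Fin n → ℝ) :
    plot sys γ ε M W T r Sinit t x - sys.optimalPolicy r T t x
      = ∑ i ∈ Finset.range (min W (T - t)), sys.Kff i *ᵥ
          (sys.A *ᵥ (r (t + i : ℕ) - prediction γ ε M r Sinit i t)
            - (r (t + (i + 1) : ℕ) - prediction γ ε M r Sinit (i + 1) t))
        + ∑ i ∈ Finset.Ico W (T - t), sys.Kff i *ᵥ sys.drift r (t + i) := by
  have h1 : ∑ i ∈ Finset.Ico t T, sys.Kff (i - t) *ᵥ (sys.A *ᵥ r i - r (i + 1))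
      = ∑ i ∈ Finset.range (T - t), sys.Kff i *ᵥ sys.drift r (t + i) := by
    rw [Finset.sum_Ico_eq_sum_range]
    refine Finset.sum_congr rfl fun i _ => ?_
    rw [Nat.add_sub_cancel_left, drift]
  have h2 : ∑ i ∈ Finset.range (T - t), sys.Kff i *ᵥ sys.drift r (t + i)
      = ∑ i ∈ Finset.range (min W (T - t)), sys.Kff i *ᵥ sys.drift r (t + i)
        + ∑ i ∈ Finset.Ico W (T - t), sys.Kff i *ᵥ sys.drift r (t + i) := by
    rcases le_total W (T - t) with h | h
    · rw [min_eq_left h, Finset.sum_range_add_sum_Ico _ h]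
    · rw [min_eq_right h, Finset.Ico_eq_empty_of_le h, Finset.sum_empty, add_zero]
  have h3 : ∑ i ∈ Finset.range (min W (T - t)), sys.Kff i *ᵥ
          (sys.A *ᵥ (r (t + i : ℕ) - prediction γ ε M r Sinit i t)
            - (r (t + (i + 1) : ℕ) - prediction γ ε M r Sinit (i + 1) t))
      = ∑ i ∈ Finset.range (min W (T - t)), sys.Kff i *ᵥ sys.drift r (t + i)
        - ∑ i ∈ Finset.range (min W (T - t)), sys.Kff i *ᵥ
          (sys.A *ᵥ prediction γ ε M r Sinit i t - prediction γ ε M r Sinit (i + 1) t) := by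
    rw [← Finset.sum_sub_distrib]
    refine Finset.sum_congr rfl fun i _ => ?_
    rw [← Matrix.mulVec_sub, drift, Matrix.mulVec_sub sys.A]
    push_cast
    congr 1
    rw [add_assoc]
    abel
  rw [plot, optimalPolicy, h1, h2, h3]
  abel

/-- The error of the `k`-step-ahead prediction made at time `t`. -/
def predictionError (γ ε M : ℝ) (r : ℤ → Fin n → ℝ)
    (Sinit : ℕ → ℕ → Matrix (Fin n) (Fin p × Fin n) ℝ) (k t : ℕ) : ℝ :=
  l2 (r (t + k : ℕ) - prediction γ ε M r Sinit k t)

lemma qform_Sig_le (v : Fin m → ℝ) : qform sys.Sig v ≤ ‖sys.Sig‖ * l2 v ^ 2 := by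
  have h1 := dotProduct_le_l2 v (sys.Sig *ᵥ v)
  have h2 := l2_mulVec_le sys.Sig v
  have h3 := l2_nonneg v
  rw [qform]
  nlinarith

lemma qform_plot_sub_optimalPolicy_le (hn : 0 < n) (hX : sys.IsRiccatiSolution sys.X)
    (hQ : sys.Q.PosDef) (hR : sys.R.PosDef) {D : ℝ} {T W t : ℕ}
    (hr : ∀ t : ℕ, t ≤ T → l2 (r t) ≤ D) (x : Fin n → ℝ) :
    qform sys.Sig (plot sys γ ε M W T r Sinit t x - sys.optimalPolicy r T t x)
      ≤ α₁ sys D * (sys.rho ^ (2 * W) / (1 - sys.rho) ^ 2) + 2 * sys.c₀ ^ 2 * ‖sys.Sig‖ *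
        (∑ i ∈ Finset.range (min W (T - t)),
          sys.rho ^ i * predictionError γ ε M r Sinit (i + 1) t) ^ 2 := by
  have h1 := l2_sum_Kff_mulVec_error_le hn hX hQ hR
    (fun i => r (t + i : ℕ) - prediction γ ε M r Sinit i t) (by simp [prediction])
    (min W (T - t))
  have h2 := l2_sum_Kff_mulVec_drift_le (t := t) (W := W) hn hX hQ hR hr
  refine (qform_Sig_le _).trans ?_
  rw [plot_sub_optimalPolicy]
  set S₁ := ∑ i ∈ Finset.range (min W (T - t)), sys.rho ^ i * predictionError γ ε M r Sinit (i + 1) t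
  have h3 := (l2_add_le _ _).trans (add_le_add h1 h2)
  calc _ ≤ ‖sys.Sig‖ * (sys.c₀ * S₁
          + sys.c₀ * ((‖sys.A‖ + 1) * D * (sys.rho ^ W / (1 - sys.rho)))) ^ 2 := by
        gcongr
        exact h3
    _ ≤ ‖sys.Sig‖ * (2 * ((sys.c₀ * S₁) ^ 2
          + (sys.c₀ * ((‖sys.A‖ + 1) * D * (sys.rho ^ W / (1 - sys.rho)))) ^ 2)) := by
        gcongr
        exact add_sq_le
    _ = _ := by
        rw [α₁, pow_mul', ← div_pow]
        ring

end PolicyDeviation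

end LQT

/-! ### Frobenius norm -/

section Frobenius

variable {ι κ μ : Type*} [Fintype ι] [Fintype κ] [Fintype μ]

lemma frob_nonneg (Y : Matrix ι κ ℝ) : 0 ≤ frob Y := Real.sqrt_nonneg _

lemma frob_sq (Y : Matrix ι κ ℝ) : frob Y ^ 2 = ∑ i, l2 (Y i) ^ 2 := by
  rw [frob, Real.sq_sqrt (by positivity)]
  simp only [l2_sq_eq_sum]

lemma frob_transpose (Y : Matrix ι κ ℝ) : frob Yᵀ = frob Y := by
  rw [frob, frob, Finset.sum_comm]
  rfl

lemma sum_l2_mul_l2_le (Y Z : Matrix ι κ ℝ) : ∑ i, l2 (Y i) * l2 (Z i) ≤ frob Y * frob Z := by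
  refine le_of_sq_le_sq ?_ (mul_nonneg (frob_nonneg _) (frob_nonneg _))
  rw [mul_pow, frob_sq, frob_sq]
  exact Finset.sum_mul_sq_le_sq_mul_sq _ _ _

lemma frob_add_le (Y Z : Matrix ι κ ℝ) : frob (Y + Z) ≤ frob Y + frob Z := by
  refine le_of_sq_le_sq ?_ (add_nonneg (frob_nonneg _) (frob_nonneg _))
  calc frob (Y + Z) ^ 2 ≤ ∑ i, (l2 (Y i) + l2 (Z i)) ^ 2 := by
        rw [frob_sq]
        gcongr with i
        exact l2_add_le _ _
    _ = frob Y ^ 2 + 2 * ∑ i, l2 (Y i) * l2 (Z i) + frob Z ^ 2 := by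
        rw [frob_sq, frob_sq, Finset.mul_sum, ← Finset.sum_add_distrib, ← Finset.sum_add_distrib]
        exact Finset.sum_congr rfl fun i _ => by ring
    _ ≤ _ := by nlinarith [sum_l2_mul_l2_le Y Z]

lemma frob_zero : frob (0 : Matrix ι κ ℝ) = 0 := by
  simp [frob]

lemma frob_neg (Y : Matrix ι κ ℝ) : frob (-Y) = frob Y := by
  simp [frob]

lemma frob_sum_le {α : Type*} (s : Finset α) (f : α → Matrix ι κ ℝ) :
    frob (∑ a ∈ s, f a) ≤ ∑ a ∈ s, frob (f a) := by
  classical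
  induction s using Finset.induction_on with
  | empty => simp [frob_zero]
  | insert a s ha ih =>
    rw [Finset.sum_insert ha, Finset.sum_insert ha]
    exact (frob_add_le _ _).trans (by gcongr)

variable [DecidableEq κ]

variable [DecidableEq ι]

lemma frob_mul_le (Y : Matrix μ κ ℝ) (R : Matrix κ ι ℝ) : frob (Y * R) ≤ frob Y * ‖R‖ := by
  refine le_of_sq_le_sq ?_ (mul_nonneg (frob_nonneg _) (norm_nonneg _))
  rw [mul_pow, frob_sq, frob_sq, Finset.sum_mul]
  refine Finset.sum_le_sum fun i _ => ?_
  have h : (Y * R) i = Rᵀ *ᵥ Y i := by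
    rw [Matrix.mulVec_transpose]
    rfl
  rw [h, mul_comm, ← mul_pow, ← opNorm_transpose R]
  gcongr
  exact l2_mulVec_le _ _

omit [DecidableEq ι] in
lemma frob_mul_le' [DecidableEq μ] (L : Matrix μ κ ℝ) (Y : Matrix κ ι ℝ) :
    frob (L * Y) ≤ ‖L‖ * frob Y := by
  rw [← frob_transpose, Matrix.transpose_mul]
  refine (frob_mul_le _ _).trans (le_of_eq ?_)
  rw [frob_transpose, opNorm_transpose, mul_comm]

lemma frob_le_sqrt_card_mul (Y : Matrix ι κ ℝ) : frob Y ≤ √(Fintype.card ι) * ‖Y‖ := by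
  refine le_of_sq_le_sq ?_ (by positivity)
  rw [mul_pow, Real.sq_sqrt (by positivity), frob_sq]
  calc ∑ i, l2 (Y i) ^ 2 ≤ ∑ _i : ι, ‖Y‖ ^ 2 := by
        gcongr with i
        have h : Y i = Yᵀ *ᵥ Pi.single i 1 := by
          rw [Matrix.mulVec_single_one]
          rfl
        rw [h, ← opNorm_transpose Y]
        refine (l2_mulVec_le _ _).trans (le_of_eq ?_)
        simp [l2]
    _ = _ := by simp

end Frobenius

/-! ### The weighted bilinear form behind `wfrob` -/

section WeightedFrobenius

variable {ι κ : Type*} [Fintype ι] [Fintype κ]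

/-- The bilinear form `tr(Y P Zᵀ)`, written row by row. -/
def wform (P : Matrix κ κ ℝ) (Y Z : Matrix ι κ ℝ) : ℝ := ∑ i, Y i ⬝ᵥ (P *ᵥ Z i)

lemma trace_mul_mul_transpose (P : Matrix κ κ ℝ) (Y : Matrix ι κ ℝ) :
    (Y * P * Yᵀ).trace = wform P Y Y := by
  refine Finset.sum_congr rfl fun i _ => ?_
  rw [Matrix.dotProduct_mulVec]
  rfl

lemma wform_self_nonneg {P : Matrix κ κ ℝ} (hP : P.PosSemidef) (Y : Matrix ι κ ℝ) :
    0 ≤ wform P Y Y :=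
  Finset.sum_nonneg fun _ _ => (posSemidef_iff_real.1 hP).2 _

lemma wform_comm {P : Matrix κ κ ℝ} (hP : Pᵀ = P) (Y Z : Matrix ι κ ℝ) :
    wform P Y Z = wform P Z Y :=
  Finset.sum_congr rfl fun _ _ => dotProduct_mulVec_comm_of_isSymm hP _ _

lemma wform_add_left (P : Matrix κ κ ℝ) (Y Y' Z : Matrix ι κ ℝ) :
    wform P (Y + Y') Z = wform P Y Z + wform P Y' Z := by
  rw [wform, wform, wform, ← Finset.sum_add_distrib]
  exact Finset.sum_congr rfl fun i _ => add_dotProduct _ _ _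

lemma wform_smul_left (P : Matrix κ κ ℝ) (a : ℝ) (Y Z : Matrix ι κ ℝ) :
    wform P (a • Y) Z = a * wform P Y Z := by
  rw [wform, wform, Finset.mul_sum]
  exact Finset.sum_congr rfl fun i _ => smul_dotProduct a (Y i) (P *ᵥ Z i)

lemma wform_add_self {P : Matrix κ κ ℝ} (hP : Pᵀ = P) (Y Z : Matrix ι κ ℝ) :
    wform P (Y + Z) (Y + Z) = wform P Y Y + 2 * wform P Y Z + wform P Z Z := by
  rw [wform_add_left, wform_comm hP Y (Y + Z), wform_comm hP Z (Y + Z), wform_add_left,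
    wform_add_left, wform_comm hP Z Y]
  ring

/-- A difference of squares. It makes the price of a moving parameter linear in `C - C'`, hence the
bound linear in the path length. -/
lemma wform_sub_self_sub {P : Matrix κ κ ℝ} (hP : Pᵀ = P) (Y C C' : Matrix ι κ ℝ) :
    wform P (Y - C') (Y - C') - wform P (Y - C) (Y - C)
      = wform P ((Y - C') + (Y - C)) (C - C') := by
  have h := wform_add_self hP (Y - C) (C - C')
  rw [sub_add_sub_cancel] at h
  rw [h, wform_add_left, ← sub_add_sub_cancel Y C C', wform_add_left]
  ring

variable [DecidableEq κ]

lemma wform_le {P : Matrix κ κ ℝ} {c : ℝ} (hc : ‖P‖ ≤ c) (Y Z : Matrix ι κ ℝ) :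
    wform P Y Z ≤ c * (frob Y * frob Z) := by
  have hc0 : 0 ≤ c := (norm_nonneg P).trans hc
  calc wform P Y Z ≤ ∑ i, c * (l2 (Y i) * l2 (Z i)) := by
        refine Finset.sum_le_sum fun i _ => ?_
        have h1 := dotProduct_le_l2 (Y i) (P *ᵥ Z i)
        have h2 : l2 (P *ᵥ Z i) ≤ c * l2 (Z i) := (l2_mulVec_le _ _).trans (by gcongr)
        have h3 := mul_le_mul_of_nonneg_left h2 (l2_nonneg (Y i))
        linarith
    _ = c * ∑ i, l2 (Y i) * l2 (Z i) := by rw [Finset.mul_sum]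
    _ ≤ _ := by gcongr; exact sum_l2_mul_l2_le _ _

end WeightedFrobenius

/-! ### Weighted projection onto the operator-norm ball -/

section Projection

variable {n p : ℕ} {M : ℝ} {P : Matrix (Fin p × Fin n) (Fin p × Fin n) ℝ}

lemma wfrob_le_wfrob_iff (hP : P.PosSemidef) (Y Z : Matrix (Fin n) (Fin p × Fin n) ℝ) :
    wfrob P Y ≤ wfrob P Z ↔ wform P Y Y ≤ wform P Z Z := by
  rw [wfrob, wfrob, trace_mul_mul_transpose, trace_mul_mul_transpose,
    Real.sqrt_le_sqrt_iff (wform_self_nonneg hP Z)]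

lemma exists_isMinOn_wfrob (hM : 0 ≤ M) (Y : Matrix (Fin n) (Fin p × Fin n) ℝ) :
    ∃ Z : Matrix (Fin n) (Fin p × Fin n) ℝ, ‖Z‖ ≤ M ∧
      ∀ Z' : Matrix (Fin n) (Fin p × Fin n) ℝ, ‖Z'‖ ≤ M → wfrob P (Z - Y) ≤ wfrob P (Z' - Y) := by
  have : ProperSpace (Matrix (Fin n) (Fin p × Fin n) ℝ) := FiniteDimensional.proper_real _
  have hc : Continuous fun Z : Matrix (Fin n) (Fin p × Fin n) ℝ => wfrob P (Z - Y) := by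
    unfold wfrob
    fun_prop
  obtain ⟨Z, hZ, hmin⟩ := (isCompact_closedBall (0 : Matrix (Fin n) (Fin p × Fin n) ℝ) M).exists_isMinOn
    ⟨0, by simpa using hM⟩ hc.continuousOn
  exact ⟨Z, by simpa using hZ, fun Z' hZ' => hmin (by simpa using hZ')⟩

lemma proj_spec (hM : 0 ≤ M) (P : Matrix (Fin p × Fin n) (Fin p × Fin n) ℝ)
    (Y : Matrix (Fin n) (Fin p × Fin n) ℝ) : ‖proj M P Y‖ ≤ M ∧
      ∀ Z' : Matrix (Fin n) (Fin p × Fin n) ℝ, ‖Z'‖ ≤ M →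
        wfrob P (proj M P Y - Y) ≤ wfrob P (Z' - Y) :=
  Classical.epsilon_spec (exists_isMinOn_wfrob hM Y)

/-- The projection does not increase the weighted distance to points of the ball. -/
lemma wform_proj_sub_le (hM : 0 ≤ M) (hP : P.PosSemidef)
    (Y : Matrix (Fin n) (Fin p × Fin n) ℝ) {C : Matrix (Fin n) (Fin p × Fin n) ℝ} (hC : ‖C‖ ≤ M) :
    wform P (proj M P Y - C) (proj M P Y - C) ≤ wform P (Y - C) (Y - C) := by
  obtain ⟨hZ, hmin⟩ := proj_spec hM P Y
  set Z := proj M P Y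
  have hPs := (posSemidef_iff_real.1 hP).1
  -- The variational inequality of a projection onto a convex set: `Z` is compared with `Z + a (C -
  -- Z)` for small `a`.
  have hvar : 0 ≤ wform P (Z - Y) (C - Z) := by
    have key : ∀ a : ℝ, 0 < a → a ≤ 1 →
        0 ≤ 2 * wform P (Z - Y) (C - Z) + a * wform P (C - Z) (C - Z) := fun a ha ha1 => by
      have hball : ‖Z + a • (C - Z)‖ ≤ M := by
        have hconv := convex_closedBall (0 : Matrix (Fin n) (Fin p × Fin n) ℝ) M
        have := hconv.add_smul_sub_mem (x := Z) (y := C) (by simpa using hZ) (by simpa using hC)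
          ⟨ha.le, ha1⟩
        simpa using this
      have h1 := (wfrob_le_wfrob_iff hP _ _).1 (hmin _ hball)
      rw [show Z + a • (C - Z) - Y = (Z - Y) + a • (C - Z) by abel, wform_add_self hPs,
        wform_comm hPs (Z - Y) (a • (C - Z)), wform_smul_left, wform_smul_left,
        wform_comm hPs (C - Z) (a • (C - Z)), wform_smul_left, wform_comm hPs (C - Z) (Z - Y)] at h1
      have h2 : 0 ≤ a * (2 * wform P (Z - Y) (C - Z) + a * wform P (C - Z) (C - Z)) := by linarith
      exact nonneg_of_mul_nonneg_right h2 ha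
    by_contra hneg
    push Not at hneg
    have hq := wform_self_nonneg hP (C - Z)
    -- This `a` keeps the quadratic term at most half of the negative linear one; the `+ 1` avoids a
    -- zero denominator.
    have h1 := key (min 1 (-wform P (Z - Y) (C - Z) / (wform P (C - Z) (C - Z) + 1)))
      (lt_min one_pos (div_pos (by linarith) (by linarith))) (min_le_left _ _)
    have h2 : min 1 (-wform P (Z - Y) (C - Z) / (wform P (C - Z) (C - Z) + 1))
        * wform P (C - Z) (C - Z) ≤ -wform P (Z - Y) (C - Z) := by
      calc _ ≤ (-wform P (Z - Y) (C - Z) / (wform P (C - Z) (C - Z) + 1))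
            * (wform P (C - Z) (C - Z) + 1) := by
            gcongr
            · exact div_nonneg (by linarith) (by linarith)
            · exact min_le_right _ _
            · linarith
        _ = _ := by field_simp
    linarith
  have h := wform_add_self hPs (Y - Z) (Z - C)
  rw [sub_add_sub_cancel] at h
  have h3 : wform P (Y - Z) (Z - C) = wform P (Z - Y) (C - Z) := by
    rw [← neg_sub Z Y, ← neg_sub C Z, ← neg_one_smul ℝ (Z - Y), ← neg_one_smul ℝ (C - Z),
      wform_smul_left, wform_comm hPs, wform_smul_left, wform_comm hPs]
    ring
  rw [h, h3]
  linarith [wform_self_nonneg hP (Y - Z)]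

end Projection

/-! ### One least-squares update -/

section RankOneUpdate

variable {ι κ : Type*} [Fintype ι] [Fintype κ]

lemma dotProduct_vecMulVec_mulVec (z v w : κ → ℝ) :
    v ⬝ᵥ (Matrix.vecMulVec z z *ᵥ w) = (v ⬝ᵥ z) * (w ⬝ᵥ z) := by
  rw [Matrix.vecMulVec_mulVec, op_smul_eq_smul, dotProduct_smul, smul_eq_mul, dotProduct_comm z w]
  ring

lemma posDef_smul_add_vecMulVec {P : Matrix κ κ ℝ} (hP : P.PosDef) {γ : ℝ} (hγ : 0 < γ)
    (z : κ → ℝ) : (γ • P + Matrix.vecMulVec z z).PosDef := by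
  have h := Matrix.posSemidef_vecMulVec_self_star z
  rw [star_trivial] at h
  exact (hP.smul hγ).add_posSemidef h

variable [DecidableEq κ]

/-- One unconstrained least-squares step, measured against the true parameter `C`. -/
lemma wform_step_eq {P : Matrix κ κ ℝ} (hP : P.PosDef) {γ : ℝ} (hγ : 0 < γ) (z : κ → ℝ)
    (S C : Matrix ι κ ℝ) :
    wform (γ • P + Matrix.vecMulVec z z)
      (S + Matrix.vecMulVec (C *ᵥ z - S *ᵥ z) z * (γ • P + Matrix.vecMulVec z z)⁻¹ - C)
      (S + Matrix.vecMulVec (C *ᵥ z - S *ᵥ z) z * (γ • P + Matrix.vecMulVec z z)⁻¹ - C)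
    = γ * wform P (S - C) (S - C) - l2 (C *ᵥ z - S *ᵥ z) ^ 2
      + l2 (C *ᵥ z - S *ᵥ z) ^ 2 * (z ⬝ᵥ ((γ • P + Matrix.vecMulVec z z)⁻¹ *ᵥ z)) := by
  have hP' := posDef_smul_add_vecMulVec hP hγ z
  have hq : ∀ v, v ⬝ᵥ ((γ • P + Matrix.vecMulVec z z) *ᵥ v)
      = γ * (v ⬝ᵥ (P *ᵥ v)) + (v ⬝ᵥ z) ^ 2 := fun v => by
    rw [Matrix.add_mulVec, dotProduct_add, dotProduct_vecMulVec_mulVec, Matrix.smul_mulVec,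
      dotProduct_smul, smul_eq_mul]
    ring
  set P' := γ • P + Matrix.vecMulVec z z
  have hPs := (posDef_iff_real.1 hP').1
  have hPinv : P' *ᵥ (P'⁻¹ *ᵥ z) = z := by
    rw [Matrix.mulVec_mulVec, Matrix.mul_nonsing_inv _ hP'.det_pos.ne'.isUnit, Matrix.one_mulVec]
  rw [l2_sq_eq_sum, wform, wform, Finset.mul_sum, Finset.sum_mul, ← Finset.sum_sub_distrib,
    ← Finset.sum_add_distrib]
  refine Finset.sum_congr rfl fun i _ => ?_
  set a := (C *ᵥ z - S *ᵥ z) i with ha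
  have hrow : (S + Matrix.vecMulVec (C *ᵥ z - S *ᵥ z) z * P'⁻¹ - C) i
      = (S - C) i + a • (P'⁻¹ *ᵥ z) := by
    have h1 : (Matrix.vecMulVec (C *ᵥ z - S *ᵥ z) z * P'⁻¹) i = a • (P'⁻¹ *ᵥ z) := by
      have h2 : z ᵥ* P'⁻¹ = P'⁻¹ *ᵥ z := by
        rw [← Matrix.mulVec_transpose, Matrix.transpose_nonsing_inv, hPs]
      rw [← h2, Matrix.vecMulVec_mul]
      rfl
    calc _ = S i + (Matrix.vecMulVec (C *ᵥ z - S *ᵥ z) z * P'⁻¹) i - C i := rfl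
      _ = S i + a • (P'⁻¹ *ᵥ z) - C i := by rw [h1]
      _ = (S i - C i) + a • (P'⁻¹ *ᵥ z) := by abel
      _ = _ := rfl
  have hδ : (S - C) i ⬝ᵥ z = -a := by
    calc (S - C) i ⬝ᵥ z = S i ⬝ᵥ z - C i ⬝ᵥ z := sub_dotProduct _ _ _
      _ = -(C i ⬝ᵥ z - S i ⬝ᵥ z) := by ring
      _ = _ := rfl
  rw [hrow]
  -- The gain `P'⁻¹ z` is chosen so that `P'` cancels here. The cross terms contribute `-2a²` and
  -- the rank-one part of `P'` contributes `a²`, which leaves `-a²`.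
  have hcross : (P'⁻¹ *ᵥ z) ⬝ᵥ (P' *ᵥ (S - C) i) = -a := by
    rw [dotProduct_mulVec_comm_of_isSymm hPs, hPinv, hδ]
  have hsq := hq ((S - C) i)
  rw [hδ] at hsq
  generalize (S - C) i = δ at *
  simp only [Matrix.mulVec_add, Matrix.mulVec_smul, dotProduct_add, add_dotProduct,
    smul_dotProduct, dotProduct_smul, smul_eq_mul, hPinv, hsq, hδ, hcross]
  rw [dotProduct_comm (P'⁻¹ *ᵥ z) z]
  ring

/-- The elliptical potential inequality for one rank-one update with forgetting. -/
lemma dotProduct_inv_mulVec_le {P : Matrix κ κ ℝ} (hP : P.PosDef) {γ : ℝ} (hγ : 0 < γ)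
    (z : κ → ℝ) : z ⬝ᵥ ((γ • P + Matrix.vecMulVec z z)⁻¹ *ᵥ z)
      ≤ Real.log (γ • P + Matrix.vecMulVec z z).det - Real.log P.det
        - Fintype.card κ * Real.log γ := by
  have hP' := posDef_smul_add_vecMulVec hP hγ z
  set P' := γ • P + Matrix.vecMulVec z z with hP'def
  -- Matrix determinant lemma for `γ P = P' - z zᵀ`. The bound then follows from `1 - 1/x ≤ log x`
  -- at `x = det P' / det (γ P)`.
  have hdet : (γ • P).det = P'.det * (1 - z ⬝ᵥ (P'⁻¹ *ᵥ z)) := by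
    have h := Matrix.det_add_replicateCol_mul_replicateRow (ι := Unit) hP'.det_pos.ne'.isUnit (-z) z
    have h1 : P' + Matrix.replicateCol Unit (-z) * Matrix.replicateRow Unit z = γ • P := by
      rw [← Matrix.vecMulVec_eq, Matrix.neg_vecMulVec, hP'def]
      abel
    rw [h1] at h
    rw [h, Matrix.det_unique (n := Unit)]
    congr 1
    simp [Matrix.mul_assoc, Matrix.mul_apply, Matrix.mulVec, dotProduct, sub_eq_add_neg]
  have hpos := hP'.det_pos
  have hPpos := hP.det_pos
  have hγP : 0 < (γ • P).det := (hP.smul hγ).det_pos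
  have hlog := Real.one_sub_inv_le_log_of_pos (div_pos hpos hγP)
  rw [Real.log_div hpos.ne' hγP.ne', Matrix.det_smul, Real.log_mul (by positivity) hPpos.ne',
    Real.log_pow, ← Matrix.det_smul, inv_div, hdet] at hlog
  have h2 : P'.det * (1 - z ⬝ᵥ (P'⁻¹ *ᵥ z)) / P'.det = 1 - z ⬝ᵥ (P'⁻¹ *ᵥ z) := by
    field_simp
  rw [h2] at hlog
  linarith

lemma dotProduct_inv_mulVec_nonneg {P : Matrix κ κ ℝ} (hP : P.PosDef) {γ : ℝ} (hγ : 0 < γ)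
    (z : κ → ℝ) : 0 ≤ z ⬝ᵥ ((γ • P + Matrix.vecMulVec z z)⁻¹ *ᵥ z) :=
  (posSemidef_iff_real.1 (posDef_smul_add_vecMulVec hP hγ z).inv.posSemidef).2 z

end RankOneUpdate

/-- Telescoping with stride `k` leaves `k` boundary terms, one per interleaved learner. -/
lemma sum_range_shift_sub (f : ℕ → ℝ) (k N : ℕ) :
    ∑ s ∈ Finset.range N, (f (s + k) - f s) = ∑ s ∈ Finset.range k, (f (N + s) - f s) := by
  have h1 := Finset.sum_range_add f N k
  have h2 := Finset.sum_range_add f k N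
  rw [add_comm k N] at h2
  simp only [Finset.sum_sub_distrib, add_comm _ k]
  linarith

/-! ### Squared errors of interleaved learners -/

section InterleavedLearners

variable {n p : ℕ} {γ ε M D : ℝ}

/-- A family of `k` interleaved recursive least-squares learners with forgetting, run for `N`
updates on data `y s = C s z s`; `L s` is the learner in charge at time `s`. -/
structure IsInterleaved (γ ε M D : ℝ) (k N : ℕ) (L : ℕ → Learner n p)
    (z : ℕ → Fin p × Fin n → ℝ) (y : ℕ → Fin n → ℝ)
    (C : ℕ → Matrix (Fin n) (Fin p × Fin n) ℝ) : Prop where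
  init_P : ∀ s < k, (L s).P = ε • 1
  init_S : ∀ s < k, ‖(L s).S‖ ≤ M
  step : ∀ s, L (s + k) = rlsStep γ M (z s) (y s) (L s)
  response : ∀ s < N, y s = C s *ᵥ z s
  norm_z : ∀ s < N, l2 (z s) ≤ √p * D
  norm_y : ∀ s < N, l2 (y s) ≤ D
  norm_C : ∀ s, ‖C s‖ ≤ M

variable {k N : ℕ} {L : ℕ → Learner n p} {z : ℕ → Fin p × Fin n → ℝ} {y : ℕ → Fin n → ℝ}
  {C : ℕ → Matrix (Fin n) (Fin p × Fin n) ℝ}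

namespace IsInterleaved

lemma norm_S (h : IsInterleaved γ ε M D k N L z y C) (hM : 0 ≤ M) (s : ℕ) : ‖(L s).S‖ ≤ M := by
  rcases lt_or_ge s k with hs | hs
  · exact h.init_S s hs
  · rw [← Nat.sub_add_cancel hs, h.step]
    exact (proj_spec hM _ _).1

lemma posDef_P (h : IsInterleaved γ ε M D k N L z y C) (hk : 1 ≤ k) (hγ : 0 < γ) (hε : 0 < ε)
    (s : ℕ) : (L s).P.PosDef := by
  induction s using Nat.strong_induction_on with
  | _ s ih =>
    rcases lt_or_ge s k with hs | hs
    · rw [h.init_P s hs]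
      exact Matrix.PosDef.one.smul hε
    · rw [← Nat.sub_add_cancel hs, h.step]
      exact posDef_smul_add_vecMulVec (ih _ (by omega)) hγ _

/-- The constant is the fixed point of `c ↦ γ c + (ε + p D²)`. The range `s < N + k` is right
because `L s` has seen the regressor `z (s - k)`. -/
lemma P_le (h : IsInterleaved γ ε M D k N L z y C) (hk : 1 ≤ k) (hγ : 0 < γ) (hγ1 : γ < 1)
    (hε : 0 < ε) {s : ℕ} (hs : s < N + k) (v : Fin p × Fin n → ℝ) :
    v ⬝ᵥ ((L s).P *ᵥ v) ≤ (ε + p * D ^ 2) / (1 - γ) * l2 v ^ 2 := by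
  have h1γ : 0 < 1 - γ := by linarith
  induction s using Nat.strong_induction_on with
  | _ s ih =>
    rcases lt_or_ge s k with hsk | hsk
    · rw [h.init_P s hsk, Matrix.smul_mulVec, Matrix.one_mulVec, dotProduct_smul, ← l2_sq,
        smul_eq_mul]
      gcongr
      rw [le_div_iff₀ h1γ]
      have : 0 ≤ (p : ℝ) * D ^ 2 := by positivity
      nlinarith
    · have h1 := ih (s - k) (by omega) (by omega)
      have h2 := dotProduct_le_l2 v (z (s - k))
      have h3 := h.norm_z (s - k) (by omega)
      have h5 : (v ⬝ᵥ z (s - k)) ^ 2 ≤ p * D ^ 2 * l2 v ^ 2 := by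
        have h6 : |v ⬝ᵥ z (s - k)| ≤ l2 v * (√p * D) := by
          refine (abs_le.2 ⟨?_, h2⟩).trans (by gcongr)
          have := dotProduct_le_l2 (-v) (z (s - k))
          rw [neg_dotProduct, l2_neg] at this
          linarith
        rw [← sq_abs]
        calc _ ≤ (l2 v * (√p * D)) ^ 2 := by gcongr
          _ = √p ^ 2 * D ^ 2 * l2 v ^ 2 := by ring
          _ = _ := by rw [Real.sq_sqrt (by positivity)]
      rw [← Nat.sub_add_cancel hsk, h.step]
      simp only [rlsStep]
      rw [Matrix.add_mulVec, dotProduct_add, dotProduct_vecMulVec_mulVec, Matrix.smul_mulVec,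
        dotProduct_smul, smul_eq_mul, ← sq]
      calc _ ≤ γ * ((ε + p * D ^ 2) / (1 - γ) * l2 v ^ 2) + p * D ^ 2 * l2 v ^ 2 := by gcongr
        _ ≤ γ * ((ε + p * D ^ 2) / (1 - γ) * l2 v ^ 2) + (ε + p * D ^ 2) * l2 v ^ 2 := by
            gcongr
            linarith
        _ = _ := by field_simp; ring

/-- The regret inequality of one update. -/
lemma error_sq_le (h : IsInterleaved γ ε M D k N L z y C) (hk : 1 ≤ k) (hγ : 0 < γ) (hγ1 : γ < 1)
    (hε : 0 < ε) (hM : 0 ≤ M) {s : ℕ} (hs : s < N) :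
    l2 (y s - (L s).S *ᵥ z s) ^ 2
      ≤ γ * wform (L s).P ((L s).S - C s) ((L s).S - C s)
        - γ * wform (L (s + k)).P ((L (s + k)).S - C (s + k)) ((L (s + k)).S - C (s + k))
        + β₁ n p ε M D / (1 - γ) * frob (C (s + k) - C s)
        + (1 + √p * M) ^ 2 * D ^ 2 * (Real.log (L (s + k)).P.det - Real.log (L s).P.det
          - (p * n : ℕ) * Real.log γ) := by
  have h1γ : 0 < 1 - γ := by linarith
  have hP := h.posDef_P hk hγ hε s
  have hP' := h.posDef_P hk hγ hε (s + k)
  have hle := opNorm_le_of_forall_dotProduct_le hP'.posSemidef (by positivity)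
    (h.P_le hk hγ hγ1 hε (by omega : s + k < N + k))
  have hC := h.norm_C s
  have hC' := h.norm_C (s + k)
  have hS' := h.norm_S hM (s + k)
  have hy := h.response s hs
  have hz := h.norm_z s hs
  have hny := h.norm_y s hs
  have hD : 0 ≤ D := (l2_nonneg _).trans hny
  have hdrift : wform (L (s + k)).P ((L (s + k)).S - C (s + k)) ((L (s + k)).S - C (s + k))
      - wform (L (s + k)).P ((L (s + k)).S - C s) ((L (s + k)).S - C s)
      ≤ β₁ n p ε M D / (1 - γ) * frob (C (s + k) - C s) := by
    rw [wform_sub_self_sub (posDef_iff_real.1 hP').1]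
    refine (wform_le hle _ _).trans ?_
    have hfr : frob ((L (s + k)).S - C (s + k) + ((L (s + k)).S - C s)) ≤ √n * (4 * M) := by
      refine (frob_le_sqrt_card_mul _).trans ?_
      rw [Fintype.card_fin]
      gcongr
      refine (norm_add_le _ _).trans ?_
      linarith [norm_sub_le (L (s + k)).S (C (s + k)), norm_sub_le (L (s + k)).S (C s)]
    rw [← neg_sub (C (s + k)) (C s), frob_neg]
    calc _ ≤ (ε + p * D ^ 2) / (1 - γ) * (√n * (4 * M) * frob (C (s + k) - C s)) := by
          gcongr
          exact frob_nonneg _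
      _ = _ := by rw [β₁]; ring
  have herr : l2 (y s - (L s).S *ᵥ z s) ^ 2 ≤ (1 + √p * M) ^ 2 * D ^ 2 := by
    rw [← mul_pow]
    gcongr
    calc _ ≤ l2 (y s) + ‖(L s).S‖ * l2 (z s) :=
          (l2_sub_le _ _).trans (by gcongr; exact l2_mulVec_le _ _)
      _ ≤ D + M * (√p * D) := by
          gcongr
          exact h.norm_S hM s
      _ = _ := by ring
  have hnn := wform_self_nonneg hP'.posSemidef ((L (s + k)).S - C (s + k))
  have hpot0 := dotProduct_inv_mulVec_nonneg hP hγ (z s)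
  have hpot := dotProduct_inv_mulVec_le hP hγ (z s)
  have hstep := wform_step_eq hP hγ (z s) (L s).S (C s)
  have hproj := wform_proj_sub_le hM (posDef_smul_add_vecMulVec hP hγ (z s)).posSemidef
    ((L s).S + Matrix.vecMulVec (C s *ᵥ z s - (L s).S *ᵥ z s) (z s) *
      (γ • (L s).P + Matrix.vecMulVec (z s) (z s))⁻¹) hC
  have e1 : (L (s + k)).P = γ • (L s).P + Matrix.vecMulVec (z s) (z s) := by
    rw [h.step]; rfl
  have e2 : (L (s + k)).S = proj M (γ • (L s).P + Matrix.vecMulVec (z s) (z s))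
      ((L s).S + Matrix.vecMulVec (C s *ᵥ z s - (L s).S *ᵥ z s) (z s) *
      (γ • (L s).P + Matrix.vecMulVec (z s) (z s))⁻¹) := by
    rw [h.step, ← hy]; rfl
  rw [← e2, hstep, ← hy, ← e1] at hproj
  rw [← e1, Fintype.card_prod, Fintype.card_fin, Fintype.card_fin] at hpot
  rw [← e1] at hpot0
  -- The new distance is available with coefficient `1`; weakening it to `γ` makes both distances
  -- terms of one telescoping sequence.
  have hγw : γ * wform (L (s + k)).P ((L (s + k)).S - C (s + k)) ((L (s + k)).S - C (s + k))
      ≤ wform (L (s + k)).P ((L (s + k)).S - C (s + k)) ((L (s + k)).S - C (s + k)) := by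
    nlinarith
  have hG : l2 (y s - (L s).S *ᵥ z s) ^ 2 * (z s ⬝ᵥ ((L (s + k)).P⁻¹ *ᵥ z s))
      ≤ (1 + √p * M) ^ 2 * D ^ 2 * (Real.log (L (s + k)).P.det - Real.log (L s).P.det
          - (p * n : ℕ) * Real.log γ) :=
    mul_le_mul herr hpot hpot0 (by positivity)
  linarith

theorem sum_error_sq_le (h : IsInterleaved γ ε M D k N L z y C) (hk : 1 ≤ k) (hγ : 0 < γ)
    (hγ1 : γ < 1) (hε : 0 < ε) (hM : 0 ≤ M) :
    ∑ s ∈ Finset.range N, l2 (y s - (L s).S *ᵥ z s) ^ 2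
      ≤ β₁ n p ε M D / (1 - γ) * ∑ s ∈ Finset.range N, frob (C (s + k) - C s)
        - β₂ n p M D * N * Real.log γ - k * (β₂ n p M D * Real.log (1 - γ))
        + k * β₄ n p γ ε M D := by
  have h1γ : 0 < 1 - γ := by linarith
  have hc : 0 < ε + p * D ^ 2 := by positivity
  set F : ℕ → ℝ := fun s => γ * wform (L s).P ((L s).S - C s) ((L s).S - C s) with hF
  set ℓ : ℕ → ℝ := fun s => Real.log (L s).P.det with hℓ
  set G : ℝ := (1 + √p * M) ^ 2 * D ^ 2 with hG
  have hG0 : 0 ≤ G := by positivity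
  have hsum := Finset.sum_le_sum fun s hs =>
    h.error_sq_le hk hγ hγ1 hε hM (Finset.mem_range.1 hs)
  refine hsum.trans ?_
  -- Only the `k` initial distances survive, each with `P = ε I` and two matrices of norm at most
  -- `M`.
  have hFsum : ∑ s ∈ Finset.range N, (F s - F (s + k)) ≤ k * (4 * γ * ε * n * M ^ 2) := by
    have h1 := sum_range_shift_sub F k N
    have h2 : ∑ s ∈ Finset.range N, (F s - F (s + k))
        = ∑ s ∈ Finset.range k, (F s - F (N + s)) := by
      rw [← neg_inj, ← Finset.sum_neg_distrib, ← Finset.sum_neg_distrib]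
      simpa only [neg_sub] using h1
    rw [h2]
    have h3 : ∀ s ∈ Finset.range k, F s - F (N + s) ≤ 4 * γ * ε * n * M ^ 2 := fun s hs => by
      have h4 : 0 ≤ F (N + s) := mul_nonneg hγ.le
        (wform_self_nonneg (h.posDef_P hk hγ hε _).posSemidef _)
      have hs := Finset.mem_range.1 hs
      have h5 : ‖(L s).P‖ ≤ ε := by
        refine opNorm_le_of_forall_dotProduct_le (h.posDef_P hk hγ hε s).posSemidef hε.le fun v => ?_
        rw [h.init_P s hs, Matrix.smul_mulVec, Matrix.one_mulVec, dotProduct_smul, ← l2_sq,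
          smul_eq_mul]
      have h6 : frob ((L s).S - C s) ≤ √n * (2 * M) := by
        refine (frob_le_sqrt_card_mul _).trans ?_
        rw [Fintype.card_fin]
        gcongr
        linarith [norm_sub_le (L s).S (C s), h.norm_C s, h.norm_S hM s]
      have h7 : F s ≤ γ * (ε * (√n * (2 * M) * (√n * (2 * M)))) := by
        refine mul_le_mul_of_nonneg_left ((wform_le h5 _ _).trans ?_) hγ.le
        have := frob_nonneg ((L s).S - C s)
        gcongr
      have h8 : √(n : ℝ) * √n = n := Real.mul_self_sqrt (by positivity)
      have h9 : γ * (ε * (√n * (2 * M) * (√n * (2 * M)))) = 4 * γ * ε * (√n * √n) * M ^ 2 := by ring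
      rw [h9, h8] at h7
      linarith
    refine (Finset.sum_le_sum h3).trans (le_of_eq ?_)
    simp
  -- The final determinants are at most `((ε + p D²) / (1 - γ))^{pn}` and the initial ones equal
  -- `ε^{pn}`; the `log (1 - γ)` term of the regret originates here.
  have hℓsum : ∑ s ∈ Finset.range N, (ℓ (s + k) - ℓ s)
      ≤ k * ((p * n : ℕ) * (Real.log ((ε + p * D ^ 2) / ε) - Real.log (1 - γ))) := by
    rw [sum_range_shift_sub]
    have h3 : ∀ s ∈ Finset.range k, ℓ (N + s) - ℓ s
        ≤ (p * n : ℕ) * (Real.log ((ε + p * D ^ 2) / ε) - Real.log (1 - γ)) := fun s hs => by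
      have hs := Finset.mem_range.1 hs
      have h4 := det_le_pow_of_forall_dotProduct_le (h.posDef_P hk hγ hε (N + s))
        (h.P_le hk hγ hγ1 hε (by omega : N + s < N + k))
      have h5 := Real.log_le_log (h.posDef_P hk hγ hε (N + s)).det_pos h4
      have h6 : ℓ s = (p * n : ℕ) * Real.log ε := by
        simp [hℓ, h.init_P s hs]
      rw [Real.log_pow, Real.log_div hc.ne' h1γ.ne', Fintype.card_prod, Fintype.card_fin,
        Fintype.card_fin] at h5
      rw [h6, Real.log_div hc.ne' hε.ne']
      simp only [hℓ]
      linarith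
    refine (Finset.sum_le_sum h3).trans (le_of_eq ?_)
    simp
  have hsplit : ∑ s ∈ Finset.range N, (F s - F (s + k)
        + β₁ n p ε M D / (1 - γ) * frob (C (s + k) - C s)
        + G * (ℓ (s + k) - ℓ s - (p * n : ℕ) * Real.log γ))
      = ∑ s ∈ Finset.range N, (F s - F (s + k))
        + β₁ n p ε M D / (1 - γ) * ∑ s ∈ Finset.range N, frob (C (s + k) - C s)
        + G * (∑ s ∈ Finset.range N, (ℓ (s + k) - ℓ s) - N * ((p * n : ℕ) * Real.log γ)) := by
    rw [Finset.sum_add_distrib, Finset.sum_add_distrib, ← Finset.mul_sum, ← Finset.mul_sum,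
      Finset.sum_sub_distrib (fun s => ℓ (s + k) - ℓ s)]
    simp
  rw [hsplit]
  have hβ₂ : β₂ n p M D = (p * n : ℕ) * G := by
    rw [β₂, hG]
    push_cast
    ring
  have := mul_le_mul_of_nonneg_left hℓsum hG0
  rw [β₄, hβ₂]
  linarith

end IsInterleaved

end InterleavedLearners

/-! ### Block vectors and companion matrices -/

section Companion

variable {n p : ℕ}

lemma l2_sq_eq_sum_blocks (v : Fin p × Fin n → ℝ) :
    l2 v ^ 2 = ∑ a, l2 (fun j => v (a, j)) ^ 2 := by
  simp only [l2_sq_eq_sum, Fintype.sum_prod_type]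

lemma l2_block_le (v : Fin p × Fin n → ℝ) (a : Fin p) : l2 (fun j => v (a, j)) ≤ l2 v := by
  refine le_of_sq_le_sq ?_ (l2_nonneg v)
  rw [l2_sq_eq_sum_blocks v]
  exact Finset.single_le_sum (f := fun a => l2 (fun j => v (a, j)) ^ 2)
    (fun _ _ => by positivity) (Finset.mem_univ a)

lemma l2_le_of_blocks_le {v : Fin p × Fin n → ℝ} {c : ℝ} (hc : 0 ≤ c)
    (h : ∀ a, l2 (fun j => v (a, j)) ≤ c) : l2 v ≤ √p * c := by
  refine le_of_sq_le_sq ?_ (by positivity)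
  rw [l2_sq_eq_sum_blocks, mul_pow, Real.sq_sqrt (by positivity)]
  calc _ ≤ ∑ _a : Fin p, c ^ 2 := by
        gcongr with a
        exact h a
    _ = _ := by simp

lemma firstBlock_mulVec (hp : 0 < p) (v : Fin p × Fin n → ℝ) :
    firstBlock n p *ᵥ v = fun j => v (⟨0, hp⟩, j) := by
  ext j
  rw [Matrix.mulVec, dotProduct, Finset.sum_eq_single (⟨0, hp⟩, j)]
  · simp [firstBlock]
  · rintro ⟨a, i⟩ - hne
    have : ¬((a : ℕ) = 0 ∧ j = i) := fun ⟨h1, h2⟩ => hne (by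
      subst h2
      exact Prod.ext (Fin.ext h1) rfl)
    simp [firstBlock, this]
  · simp

lemma companion_mulVec_of_eq_zero (S : Matrix (Fin n) (Fin p × Fin n) ℝ)
    (v : Fin p × Fin n → ℝ) {a : Fin p} (ha : (a : ℕ) = 0) (j : Fin n) :
    (companion S *ᵥ v) (a, j) = (S *ᵥ v) j := by
  simp [companion, Matrix.mulVec, dotProduct, ha]

lemma companion_mulVec_of_eq_succ (S : Matrix (Fin n) (Fin p × Fin n) ℝ)
    (v : Fin p × Fin n → ℝ) {a b : Fin p} (hab : (a : ℕ) = b + 1) (j : Fin n) :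
    (companion S *ᵥ v) (a, j) = v (b, j) := by
  rw [Matrix.mulVec, dotProduct, Finset.sum_eq_single (b, j)]
  · simp [companion, hab]
  · rintro ⟨c, i⟩ - hne
    have : ¬((a : ℕ) = (c : ℕ) + 1 ∧ j = i) := fun ⟨h1, h2⟩ => hne (by
      subst h2
      exact Prod.ext (Fin.ext (by simp; omega)) rfl)
    have ha : (a : ℕ) ≠ 0 := by omega
    simp only [companion, Matrix.of_apply, ha, if_false, this, zero_mul]
  · simp

lemma companion_sub (S S' : Matrix (Fin n) (Fin p × Fin n) ℝ) :
    companion S' - companion S = (firstBlock n p)ᵀ * (S' - S) := by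
  ext ⟨a, i⟩ b
  rw [Matrix.mul_apply, Finset.sum_eq_single i]
  · by_cases ha : (a : ℕ) = 0 <;> simp [companion, firstBlock, ha]
  · intro j _ hj
    simp [firstBlock, hj]
  · simp

lemma opNorm_firstBlock_le (hp : 0 < p) : ‖firstBlock n p‖ ≤ 1 :=
  opNorm_le_of_l2_mulVec_le _ zero_le_one fun v => by
    rw [firstBlock_mulVec hp, one_mul]
    exact l2_block_le v _

end Companion

/-! ### Multi-step target dynamics and their variation -/

section Target

variable {n p T W : ℕ} {M D : ℝ} {r : ℤ → Fin n → ℝ} {S : ℕ → Matrix (Fin n) (Fin p × Fin n) ℝ}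

lemma regressor_eq (hdyn : ∀ t : ℕ, t ≤ T → r t = S t *ᵥ regressor p r ((t : ℤ) - 1))
    {t : ℕ} (ht : t ≤ T) : regressor p r t = companion (S t) *ᵥ regressor p r ((t : ℤ) - 1) := by
  ext ⟨⟨a, ha⟩, j⟩
  cases a with
  | zero =>
    rw [companion_mulVec_of_eq_zero _ _ rfl, ← hdyn t ht]
    simp [regressor]
  | succ a =>
    rw [companion_mulVec_of_eq_succ (b := ⟨a, by omega⟩) _ _ rfl]
    simp only [regressor]
    congr 1
    push_cast
    ring_nf

lemma regressor_eq_transition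
    (hdyn : ∀ t : ℕ, t ≤ T → r t = S t *ᵥ regressor p r ((t : ℤ) - 1)) {s k : ℕ}
    (h : s + k ≤ T + 1) : regressor p r ((s : ℤ) + k - 1)
      = transition S s k *ᵥ regressor p r ((s : ℤ) - 1) := by
  induction k with
  | zero => simp [transition]
  | succ k ih =>
    rw [transition, ← Matrix.mulVec_mulVec, ← ih (by omega)]
    have := regressor_eq hdyn (t := s + k) (by omega)
    push_cast at this ⊢
    rw [← this]
    congr 1
    ring

lemma target_eq_multiStep (hp : 0 < p)
    (hdyn : ∀ t : ℕ, t ≤ T → r t = S t *ᵥ regressor p r ((t : ℤ) - 1)) {s k : ℕ}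
    (h : s + k ≤ T + 1) :
    r ((s : ℤ) + k - 1) = multiStep S s k *ᵥ regressor p r ((s : ℤ) - 1) := by
  rw [multiStep, ← Matrix.mulVec_mulVec, ← regressor_eq_transition hdyn h, firstBlock_mulVec hp]
  ext j
  simp [regressor]

lemma l2_regressor_le (hr : ∀ t : ℤ, -(p : ℤ) ≤ t → t ≤ (T : ℤ) → l2 (r t) ≤ D) (hD : 0 ≤ D)
    {t : ℤ} (h1 : -1 ≤ t) (h2 : t ≤ T) : l2 (regressor p r t) ≤ √p * D :=
  l2_le_of_blocks_le hD fun a => by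
    change l2 (r (t - (a : ℕ))) ≤ D
    -- The oldest entry of `z_{-1}` is `r_{-p}`, the earliest target covered by the bound.
    exact hr _ (by omega) (by omega)

variable (hp : 0 < p)
  (hS : ∀ s k : ℕ, 1 ≤ k → k ≤ W → s + k ≤ T + 1 → ‖multiStep S s k‖ ≤ M)

include hp hS in
lemma opNorm_multiStep_le {s k : ℕ} (hk : k ≤ W) (h : s + k ≤ T + 1) :
    ‖multiStep S s k‖ ≤ max M 1 := by
  rcases Nat.eq_zero_or_pos k with rfl | hk0
  · rw [multiStep, transition, Matrix.mul_one]
    exact (opNorm_firstBlock_le hp).trans (le_max_right _ _)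
  · exact (hS s k hk0 hk h).trans (le_max_left _ _)

-- Block `a` of `Φ v` is the first block of a product with `a` fewer factors, because companion
-- matrices shift blocks down; blocks of `v` that are not yet shifted out account for the `1` in
-- `max M 1`.
include hp hS in
lemma l2_block_transition_le {s k : ℕ} (hk : k ≤ W) (h : s + k ≤ T + 1)
    (v : Fin p × Fin n → ℝ) (a : Fin p) :
    l2 (fun j => (transition S s k *ᵥ v) (a, j)) ≤ max M 1 * l2 v := by
  induction k generalizing a with
  | zero =>
    rw [transition, Matrix.one_mulVec]
    exact (l2_block_le v a).trans (le_mul_of_one_le_left (l2_nonneg v) (le_max_right _ _))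
  | succ k ih =>
    obtain ⟨a, ha⟩ := a
    cases a with
    | zero =>
      rw [← firstBlock_mulVec hp, Matrix.mulVec_mulVec]
      exact (l2_mulVec_le _ _).trans (mul_le_mul_of_nonneg_right
        (opNorm_multiStep_le hp hS hk h) (l2_nonneg v))
    | succ a =>
      have := ih (by omega) (by omega) ⟨a, by omega⟩
      simpa only [transition, ← Matrix.mulVec_mulVec,
        companion_mulVec_of_eq_succ (a := ⟨a + 1, ha⟩) (b := ⟨a, by omega⟩) _ _ rfl] using this

include hp hS in
lemma opNorm_transition_le {s k : ℕ} (hk : k ≤ W) (h : s + k ≤ T + 1) :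
    ‖transition S s k‖ ≤ √p * max M 1 := by
  have hM1 : 0 ≤ max M 1 := zero_le_one.trans (le_max_right _ _)
  refine opNorm_le_of_l2_mulVec_le _ (by positivity) fun v => ?_
  rw [mul_assoc]
  exact l2_le_of_blocks_le (mul_nonneg hM1 (l2_nonneg v)) (l2_block_transition_le hp hS hk h v)

/-- The factors of the two products are exchanged one at a time, and two companion matrices differ
only in their first block row. -/
lemma transition_succ_sub (s k : ℕ) : transition S (s + 1) k - transition S s k
    = ∑ l ∈ Finset.range k, transition S (s + l + 2) (k - (l + 1)) * (firstBlock n p)ᵀ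
        * (S (s + l + 1) - S (s + l)) * transition S s l := by
  induction k with
  | zero => simp [transition]
  | succ k ih =>
    have h1 : transition S (s + 1) (k + 1) - transition S s (k + 1)
        = companion (S (s + k + 1)) * (transition S (s + 1) k - transition S s k)
          + (companion (S (s + k + 1)) - companion (S (s + k))) * transition S s k := by
      rw [transition, transition, Matrix.mul_sub, Matrix.sub_mul, show s + 1 + k = s + k + 1 by ring]
      abel
    rw [h1, ih, Finset.sum_range_succ, companion_sub, Finset.mul_sum]
    congr 1
    · refine Finset.sum_congr rfl fun l hl => ?_
      rw [Finset.mem_range] at hl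
      rw [show k + 1 - (l + 1) = k - (l + 1) + 1 by omega, transition,
        show s + l + 2 + (k - (l + 1)) = s + k + 1 by omega]
      simp only [Matrix.mul_assoc]
    · simp [transition]

include hp hS in
lemma frob_multiStep_succ_sub_le {s k : ℕ} (hk : k ≤ W) (h : s + k ≤ T) :
    frob (multiStep S (s + 1) k - multiStep S s k)
      ≤ √p * max M 1 ^ 2 * ∑ l ∈ Finset.range k, frob (S (s + l + 1) - S (s + l)) := by
  have hM1 : 0 ≤ max M 1 := zero_le_one.trans (le_max_right _ _)
  rw [multiStep, multiStep, ← Matrix.mul_sub, transition_succ_sub, Matrix.mul_sum,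
    Finset.mul_sum]
  refine (frob_sum_le _ _).trans (Finset.sum_le_sum fun l hl => ?_)
  rw [Finset.mem_range] at hl
  have h1 := opNorm_multiStep_le hp hS (s := s + l + 2) (k := k - (l + 1)) (by omega) (by omega)
  have h2 := opNorm_transition_le hp hS (s := s) (k := l) (by omega) (by omega)
  have h3 : ‖(firstBlock n p)ᵀ‖ ≤ 1 := by
    rw [opNorm_transpose]
    exact opNorm_firstBlock_le hp
  -- The left product enters only through its first block row, so just the right product costs a
  -- `√p`.
  have h4 : ‖multiStep S (s + l + 2) (k - (l + 1)) * (firstBlock n p)ᵀ‖ ≤ max M 1 * 1 :=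
    (Matrix.l2_opNorm_mul _ _).trans (mul_le_mul h1 h3 (norm_nonneg _) hM1)
  have hd := frob_nonneg (S (s + l + 1) - S (s + l))
  rw [← Matrix.mul_assoc, ← Matrix.mul_assoc, ← Matrix.mul_assoc, ← multiStep]
  calc _ ≤ frob (multiStep S (s + l + 2) (k - (l + 1)) * (firstBlock n p)ᵀ
          * (S (s + l + 1) - S (s + l))) * ‖transition S s l‖ := frob_mul_le _ _
    _ ≤ ‖multiStep S (s + l + 2) (k - (l + 1)) * (firstBlock n p)ᵀ‖
          * frob (S (s + l + 1) - S (s + l)) * ‖transition S s l‖ := by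
        gcongr
        exact frob_mul_le' _ _
    _ ≤ (max M 1 * 1) * frob (S (s + l + 1) - S (s + l)) * (√p * max M 1) := by gcongr
    _ = _ := by ring

/-- The `k`-step transition matrices, frozen beyond the horizon. -/
def clampedMultiStep (S : ℕ → Matrix (Fin n) (Fin p × Fin n) ℝ) (T k s : ℕ) :
    Matrix (Fin n) (Fin p × Fin n) ℝ :=
  multiStep S (min s (T + 1 - k)) k

lemma sum_range_shift_le {f : ℕ → ℝ} (hf : ∀ s, 0 ≤ f s) {N N' j : ℕ} (h : j + N ≤ N') :
    ∑ s ∈ Finset.range N, f (s + j) ≤ ∑ s ∈ Finset.range N', f s := by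
  calc _ ≤ ∑ s ∈ Finset.range (j + N), f s := by
        rw [Finset.sum_range_add]
        simp only [add_comm j]
        exact le_add_of_nonneg_left (Finset.sum_nonneg fun _ _ => hf _)
    _ ≤ _ := Finset.sum_le_sum_of_subset_of_nonneg (by simpa using h) fun _ _ _ => hf _

include hp hS in
lemma sum_frob_clampedMultiStep_sub_le {k : ℕ} (hkW : k ≤ W) (hkT : k ≤ T) (N : ℕ) :
    ∑ s ∈ Finset.range N, frob (clampedMultiStep S T k (s + k) - clampedMultiStep S T k s)
      ≤ k ^ 2 * (√p * max M 1 ^ 2 * pathLength S T) := by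
  set d : ℕ → ℝ := fun s => frob (clampedMultiStep S T k (s + 1) - clampedMultiStep S T k s) with hd
  have hd0 : ∀ s, 0 ≤ d s := fun s => frob_nonneg _
  -- Beyond the horizon the parameter is frozen: `C (s + k)` is needed at indices where no bound on
  -- `multiStep` is assumed, and freezing adds no variation.
  have hdz : ∀ s, T + 1 - k ≤ s → d s = 0 := fun s hs => by
    simp only [hd, clampedMultiStep]
    rw [min_eq_right hs, min_eq_right (by omega), sub_self, frob_zero]
  have hdsum : ∀ N', ∑ s ∈ Finset.range N', d s ≤ k * (√p * max M 1 ^ 2 * pathLength S T) := by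
    intro N'
    calc _ ≤ ∑ s ∈ Finset.range (N' + (T + 1 - k)), d s :=
          Finset.sum_le_sum_of_subset_of_nonneg (by simp) fun _ _ _ => hd0 _
      _ = ∑ s ∈ Finset.range (T + 1 - k), d s := by
          symm
          refine Finset.sum_subset (by simp) fun s _ hs => hdz s (by simpa using hs)
      _ ≤ ∑ s ∈ Finset.range (T + 1 - k), √p * max M 1 ^ 2 *
            ∑ l ∈ Finset.range k, frob (S (s + l + 1) - S (s + l)) := by
          refine Finset.sum_le_sum fun s hs => ?_
          rw [Finset.mem_range] at hs
          simp only [hd, clampedMultiStep]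
          rw [min_eq_left (by omega), min_eq_left (by omega)]
          exact frob_multiStep_succ_sub_le hp hS hkW (by omega)
      _ = √p * max M 1 ^ 2 * ∑ l ∈ Finset.range k, ∑ s ∈ Finset.range (T + 1 - k),
            frob (S (s + l + 1) - S (s + l)) := by
          rw [← Finset.mul_sum, Finset.sum_comm]
      _ ≤ √p * max M 1 ^ 2 * ∑ _l ∈ Finset.range k, pathLength S T := by
          gcongr with l hl
          rw [Finset.mem_range] at hl
          exact sum_range_shift_le (f := fun i => frob (S (i + 1) - S i))
            (fun _ => frob_nonneg _) (by omega)
      _ = _ := by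
          rw [Finset.sum_const, Finset.card_range, nsmul_eq_mul]
          ring
  -- A jump of length `k` is split into `k` unit steps; this is the second factor `k`.
  calc _ ≤ ∑ s ∈ Finset.range N, ∑ j ∈ Finset.range k, d (s + j) := by
        refine Finset.sum_le_sum fun s _ => ?_
        have := Finset.sum_range_sub (fun j => clampedMultiStep S T k (s + j)) k
        simp only [add_zero] at this
        rw [← this]
        exact frob_sum_le _ _
    _ = ∑ j ∈ Finset.range k, ∑ s ∈ Finset.range N, d (s + j) := Finset.sum_comm
    _ ≤ ∑ _j ∈ Finset.range k, k * (√p * max M 1 ^ 2 * pathLength S T) :=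
        Finset.sum_le_sum fun j _ => (sum_range_shift_le hd0 le_rfl).trans (hdsum _)
    _ = _ := by
        rw [Finset.sum_const, Finset.card_range, nsmul_eq_mul]
        ring

end Target

/-! ### Accumulated error of the `k`-step predictor -/

section PredictionErrors

variable {n p T W : ℕ} {γ ε M D : ℝ} {r : ℤ → Fin n → ℝ}
  {S : ℕ → Matrix (Fin n) (Fin p × Fin n) ℝ}
  {Sinit : ℕ → ℕ → Matrix (Fin n) (Fin p × Fin n) ℝ}

/-- The learner of the `k`-step-ahead predictor in charge at time `s - 1`. -/
def learnerAt (γ ε M : ℝ) (r : ℤ → Fin n → ℝ)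
    (Sinit : ℕ → ℕ → Matrix (Fin n) (Fin p × Fin n) ℝ) (k s : ℕ) : Learner n p :=
  learner γ ε M r k (s % k) (Sinit k (s % k)) (s / k)

/-- Passing from `s` to `s + k` keeps the residue, hence the learner, and raises its number of
updates by one. -/
lemma learnerAt_add {k : ℕ} (hk : 1 ≤ k) (s : ℕ) : learnerAt γ ε M r Sinit k (s + k)
    = rlsStep γ M (regressor p r ((s : ℤ) - 1)) (r ((s : ℤ) + k - 1))
      (learnerAt γ ε M r Sinit k s) := by
  have h : ((s / k : ℕ) : ℤ) * k + (s % k : ℕ) = s := by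
    exact_mod_cast Nat.div_add_mod' s k
  rw [learnerAt, Nat.add_mod_right, Nat.add_div_right _ hk, learner, learnerAt, h, add_mul,
    add_right_comm, h, one_mul]

/-- Index `s` stands for time `s - 1`, so the response is `r_{s+k-1}`; it lies within the horizon
exactly for `s < T + 2 - k`. -/
lemma isInterleaved_learnerAt (hp : 0 < p)
    (hr : ∀ t : ℤ, -(p : ℤ) ≤ t → t ≤ (T : ℤ) → l2 (r t) ≤ D)
    (hdyn : ∀ t : ℕ, t ≤ T → r t = S t *ᵥ regressor p r ((t : ℤ) - 1))
    (hS : ∀ s k : ℕ, 1 ≤ k → k ≤ W → s + k ≤ T + 1 → ‖multiStep S s k‖ ≤ M)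
    (hSinit : ∀ k i : ℕ, 1 ≤ k → k ≤ W → i < k → ‖Sinit k i‖ ≤ M)
    {k : ℕ} (hk : 1 ≤ k) (hkW : k ≤ W) (hkT : k ≤ T) :
    IsInterleaved γ ε M D k (T + 2 - k) (learnerAt γ ε M r Sinit k)
      (fun s => regressor p r ((s : ℤ) - 1)) (fun s => r ((s : ℤ) + k - 1))
      (clampedMultiStep S T k) where
  init_P s hs := by simp [learnerAt, Nat.div_eq_of_lt hs, learner]
  init_S s hs := by
    simpa [learnerAt, Nat.div_eq_of_lt hs, Nat.mod_eq_of_lt hs, learner]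
      using hSinit k s hk hkW hs
  step := learnerAt_add hk
  response s hs := by
    rw [clampedMultiStep, min_eq_left (by omega)]
    exact target_eq_multiStep hp hdyn (by omega)
  norm_z s hs := l2_regressor_le hr ((l2_nonneg _).trans (hr 0 (by omega) (by omega)))
    (by omega) (by omega)
  norm_y s hs := hr _ (by omega) (by omega)
  norm_C s := hS _ _ hk hkW (by omega)

lemma predictionError_eq {k : ℕ} (hk : 1 ≤ k) (t : ℕ) :
    LQT.predictionError γ ε M r Sinit k t = l2 (r (((t + 1 : ℕ) : ℤ) + k - 1)
      - (learnerAt γ ε M r Sinit k (t + 1)).S *ᵥ regressor p r (((t + 1 : ℕ) : ℤ) - 1)) := by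
  rw [LQT.predictionError, prediction, if_neg (by omega), estimate, learnerAt]
  push_cast
  rw [add_sub_cancel_right, add_right_comm, add_sub_cancel_right]

lemma β₁_nonneg (hε : 0 < ε) (hM : 0 ≤ M) : 0 ≤ β₁ n p ε M D := by
  rw [β₁]
  positivity

lemma β₂_nonneg : 0 ≤ β₂ n p M D := by
  rw [β₂]
  positivity

lemma β₄_nonneg (hγ : 0 < γ) (hε : 0 < ε) : 0 ≤ β₄ n p γ ε M D := by
  have h1 : 0 ≤ Real.log ((ε + p * D ^ 2) / ε) := by
    refine Real.log_nonneg ((one_le_div hε).2 ?_)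
    have : 0 ≤ (p : ℝ) * D ^ 2 := by positivity
    linarith
  have h2 := β₂_nonneg (n := n) (p := p) (M := M) (D := D)
  rw [β₄]
  positivity

lemma pathLength_nonneg : 0 ≤ pathLength S T := Finset.sum_nonneg fun _ _ => frob_nonneg _

/-- Accumulated squared error of the `k`-step-ahead predictor. -/
theorem sum_predictionError_sq_le (hp : 0 < p) (hγ : 0 < γ) (hγ1 : γ < 1) (hε : 0 < ε)
    (hM : 0 ≤ M) (hr : ∀ t : ℤ, -(p : ℤ) ≤ t → t ≤ (T : ℤ) → l2 (r t) ≤ D)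
    (hdyn : ∀ t : ℕ, t ≤ T → r t = S t *ᵥ regressor p r ((t : ℤ) - 1))
    (hS : ∀ s k : ℕ, 1 ≤ k → k ≤ W → s + k ≤ T + 1 → ‖multiStep S s k‖ ≤ M)
    (hSinit : ∀ k i : ℕ, 1 ≤ k → k ≤ W → i < k → ‖Sinit k i‖ ≤ M)
    {k : ℕ} (hk : 1 ≤ k) (hkW : k ≤ W) :
    ∑ t ∈ Finset.range (T + 1 - k), LQT.predictionError γ ε M r Sinit k t ^ 2
      ≤ k ^ 2 * (β₁ n p ε M D * √p * max M 1 ^ 2 * (pathLength S T / (1 - γ)))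
        + -(β₂ n p M D * (T + 1) * Real.log γ)
        + k * (-(β₂ n p M D * Real.log (1 - γ)) + β₄ n p γ ε M D) := by
  have h1γ : 0 < 1 - γ := by linarith
  have hβ₁ := β₁_nonneg (n := n) (p := p) (D := D) hε hM
  have hβ₂ := β₂_nonneg (n := n) (p := p) (M := M) (D := D)
  have hβ₄ := β₄_nonneg (n := n) (p := p) (M := M) (D := D) hγ hε
  have hV := pathLength_nonneg (S := S) (T := T)
  have hlog1 : Real.log γ ≤ 0 := Real.log_nonpos hγ.le hγ1.le
  have hlog2 : Real.log (1 - γ) ≤ 0 := Real.log_nonpos h1γ.le (by linarith)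
  rcases lt_or_ge T k with hkT | hkT
  · rw [show T + 1 - k = 0 by omega, Finset.sum_range_zero]
    have h1 : 0 ≤ -(β₂ n p M D * (T + 1) * Real.log γ) := by
      rw [← mul_neg]
      exact mul_nonneg (by positivity) (by linarith)
    have h2 : 0 ≤ -(β₂ n p M D * Real.log (1 - γ)) := by
      rw [← mul_neg]
      exact mul_nonneg (by positivity) (by linarith)
    positivity
  have h := (isInterleaved_learnerAt hp hr hdyn hS hSinit hk hkW hkT (γ := γ)
    (ε := ε)).sum_error_sq_le hk hγ hγ1 hε hM
  -- The term `s = 0` is the prediction made at time `-1`. It is learned from but does not enter the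
  -- regret, and being a square it is dropped.
  rw [show T + 2 - k = T + 1 - k + 1 by omega, Finset.sum_range_succ'] at h
  have hvar := sum_frob_clampedMultiStep_sub_le hp hS hkW hkT (T + 1 - k + 1)
  have h3 : β₁ n p ε M D / (1 - γ) * ∑ s ∈ Finset.range (T + 1 - k + 1),
      frob (clampedMultiStep S T k (s + k) - clampedMultiStep S T k s)
      ≤ k ^ 2 * (β₁ n p ε M D * √p * max M 1 ^ 2 * (pathLength S T / (1 - γ))) := by
    refine (mul_le_mul_of_nonneg_left hvar (by positivity)).trans (le_of_eq ?_)
    ring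
  have h4 : -(β₂ n p M D * (T + 1 - k + 1 : ℕ) * Real.log γ)
      ≤ -(β₂ n p M D * (T + 1) * Real.log γ) := by
    rw [← mul_neg, ← mul_neg]
    have : ((T + 1 - k + 1 : ℕ) : ℝ) ≤ T + 1 := by
      exact_mod_cast (by omega : T + 1 - k + 1 ≤ T + 1)
    gcongr
    linarith
  have h5 := sq_nonneg (l2 (r (((0 : ℕ) : ℤ) + k - 1)
      - (learnerAt γ ε M r Sinit k 0).S *ᵥ regressor p r (((0 : ℕ) : ℤ) - 1)))
  simp only [predictionError_eq hk]
  have h6 := (le_add_of_nonneg_right h5).trans h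
  refine h6.trans ?_
  linarith

end PredictionErrors

/-! ### Polynomially weighted geometric sums -/

section GeometricSums

variable {ρ : ℝ}

lemma sum_pow_le (h0 : 0 ≤ ρ) (h1 : ρ < 1) (N : ℕ) :
    ∑ i ∈ Finset.range N, ρ ^ i ≤ min (N : ℝ) (1 - ρ)⁻¹ := by
  refine le_min ?_ ?_
  · calc _ ≤ ∑ _i ∈ Finset.range N, (1 : ℝ) := by
          gcongr with i
          exact pow_le_one₀ h0 h1.le
      _ = _ := by simp
  · have := geom_sum_Ico_le_of_lt_one h0 h1 (m := 0) (n := N)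
    simpa using this

lemma sum_mul_pow_le (h0 : 0 ≤ ρ) (h1 : ρ < 1) (N : ℕ) :
    ∑ i ∈ Finset.range N, ((i + 1 : ℕ) : ℝ) * ρ ^ i ≤ min (N : ℝ) (1 - ρ)⁻¹ ^ 2 := by
  have hpos : 0 < 1 - ρ := by linarith
  have hsum := sum_pow_le h0 h1 N
  rcases le_total (N : ℝ) (1 - ρ)⁻¹ with h | h
  · rw [min_eq_left h] at hsum ⊢
    calc _ ≤ ∑ i ∈ Finset.range N, (N : ℝ) * ρ ^ i := by
          refine Finset.sum_le_sum fun i hi => ?_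
          have : ((i + 1 : ℕ) : ℝ) ≤ N := by exact_mod_cast Finset.mem_range.1 hi
          gcongr
      _ ≤ _ := by
          rw [← Finset.mul_sum, sq]
          gcongr
  · rw [min_eq_right h] at hsum ⊢
    -- Multiplication by `1 - ρ` lowers the degree of the weight by one.
    have hid : (1 - ρ) * ∑ i ∈ Finset.range N, ((i + 1 : ℕ) : ℝ) * ρ ^ i
        = ∑ i ∈ Finset.range N, ρ ^ i - N * ρ ^ N := by
      clear hsum h
      induction N with
      | zero => simp
      | succ N ih =>
        rw [Finset.sum_range_succ, mul_add, ih, Finset.sum_range_succ _ N]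
        push_cast
        ring
    have h2 : 0 ≤ (N : ℝ) * ρ ^ N := by positivity
    rw [sq, ← div_eq_mul_inv, le_div_iff₀ hpos, mul_comm, hid]
    linarith

lemma sum_sq_mul_pow_le (h0 : 0 ≤ ρ) (h1 : ρ < 1) (N : ℕ) :
    ∑ i ∈ Finset.range N, ((i + 1 : ℕ) : ℝ) ^ 2 * ρ ^ i ≤ 2 * min (N : ℝ) (1 - ρ)⁻¹ ^ 3 := by
  have hpos : 0 < 1 - ρ := by linarith
  have hsum := sum_mul_pow_le h0 h1 N
  rcases le_total (N : ℝ) (1 - ρ)⁻¹ with h | h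
  · rw [min_eq_left h] at hsum ⊢
    have hN : 0 ≤ (N : ℝ) ^ 3 := by positivity
    calc _ ≤ ∑ i ∈ Finset.range N, (N : ℝ) * (((i + 1 : ℕ) : ℝ) * ρ ^ i) := by
          refine Finset.sum_le_sum fun i hi => ?_
          have : ((i + 1 : ℕ) : ℝ) ≤ N := by exact_mod_cast Finset.mem_range.1 hi
          rw [sq, mul_assoc]
          gcongr
      _ ≤ (N : ℝ) * (N : ℝ) ^ 2 := by
          rw [← Finset.mul_sum]
          gcongr
      _ ≤ _ := by linarith
  · rw [min_eq_right h] at hsum ⊢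
    -- From `(i+1)² - i² = 2(i+1) - 1`. The `2` here is what makes the leading constant of `α₂` a
    -- `4`.
    have hid : (1 - ρ) * ∑ i ∈ Finset.range N, ((i + 1 : ℕ) : ℝ) ^ 2 * ρ ^ i
        = ∑ i ∈ Finset.range N, (2 * (((i + 1 : ℕ) : ℝ) * ρ ^ i) - ρ ^ i) - N ^ 2 * ρ ^ N := by
      clear hsum h
      induction N with
      | zero => simp
      | succ N ih =>
        rw [Finset.sum_range_succ, mul_add, ih, Finset.sum_range_succ _ N]
        push_cast
        ring
    have h2 : 0 ≤ (N : ℝ) ^ 2 * ρ ^ N := by positivity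
    have h3 : 0 ≤ ∑ i ∈ Finset.range N, ρ ^ i := Finset.sum_nonneg fun _ _ => by positivity
    rw [Finset.sum_sub_distrib, ← Finset.mul_sum] at hid
    rw [pow_succ, ← mul_assoc, ← div_eq_mul_inv, le_div_iff₀ hpos, mul_comm, hid]
    linarith

end GeometricSums

end

end PLOT

/-! ### The regret bound -/

open PLOT in
theorem mainTheorem1 {n m p : ℕ} (hn : 0 < n) (hp : 0 < p)
    -- the system: stabilizable, with positive definite weights
    (sys : PLOT.LQT n m)
    (hstab : PLOT.Stabilizable sys.A sys.B)
    (hQ : sys.Q.PosDef) (hR : sys.R.PosDef)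
    -- time horizon, prediction horizon, forgetting factor, regularization, bounds
    (T W : ℕ) (hW : 1 ≤ W)
    (γ ε M D : ℝ) (hγ0 : 0 < γ) (hγ1 : γ < 1) (hε : 0 < ε)
    -- the target is bounded and follows the autoregressive dynamics `r_t = S_t z_{t-1}`
    (r : ℤ → Fin n → ℝ)
    (hr : ∀ t : ℤ, -(p : ℤ) ≤ t → t ≤ (T : ℤ) → ‖WithLp.toLp 2 (r t)‖ ≤ D)
    (S : ℕ → Matrix (Fin n) (Fin p × Fin n) ℝ)
    (hdyn : ∀ t : ℕ, t ≤ T → r t = S t *ᵥ PLOT.regressor p r ((t : ℤ) - 1))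
    -- bounded `k`-step transition matrices: `‖S_{t+k|t}‖ ≤ M` for `t = s - 1`, `t + k ≤ T`
    (hS : ∀ s k : ℕ, 1 ≤ k → k ≤ W → s + k ≤ T + 1 → ‖PLOT.multiStep S s k‖ ≤ M)
    -- the learners start from arbitrary estimates of norm at most `M`
    (Sinit : ℕ → ℕ → Matrix (Fin n) (Fin p × Fin n) ℝ)
    (hSinit : ∀ k i : ℕ, 1 ≤ k → k ≤ W → i < k → ‖Sinit k i‖ ≤ M)
    (x₀ : Fin n → ℝ) :
    -- the comparator policy is optimal among all input sequences
    (∀ u : ℕ → Fin m → ℝ,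
      sys.cost r T x₀ (sys.inputs x₀ (sys.optimalPolicy r T)) ≤ sys.cost r T x₀ u) ∧
    -- the regret bound
    sys.regret r T x₀ (PLOT.plot sys γ ε M W T r Sinit) ≤
      PLOT.α₁ sys D * (sys.rho ^ (2 * W) / (1 - sys.rho) ^ 2) * T
        + PLOT.α₂ sys p ε M D * PLOT.Wtilde sys W ^ 4 * (PLOT.pathLength S T / (1 - γ))
        - PLOT.α₃ sys p M D * PLOT.Wtilde sys W ^ 2 * (T + 1) * Real.log γ
        - PLOT.α₄ sys p M D * PLOT.Wtilde sys W ^ 3 * Real.log (1 - γ)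
        + PLOT.α₅ sys p γ ε M D * PLOT.Wtilde sys W ^ 3 := by
  have hX := LQT.isRiccatiSolution_X hn hstab hQ hR
  refine ⟨LQT.cost_optimalPolicy_le hX hR r T x₀, ?_⟩
  have h1γ : 0 < 1 - γ := by linarith
  have hM : 0 ≤ M := (norm_nonneg _).trans (hS 0 1 le_rfl hW (by omega))
  have hρ0 := LQT.rho_nonneg (sys := sys)
  have hρ1 := LQT.rho_lt_one hn hX hQ hR
  have hβ₁ := β₁_nonneg (n := n) (p := p) (D := D) hε hM
  have hβ₂ := β₂_nonneg (n := n) (p := p) (M := M) (D := D)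
  have hβ₄ := β₄_nonneg (n := n) (p := p) (M := M) (D := D) hγ0 hε
  have hV := pathLength_nonneg (S := S) (T := T)
  set a : ℝ := β₁ n p ε M D * √p * max M 1 ^ 2 * (pathLength S T / (1 - γ)) with ha
  set b : ℝ := -(β₂ n p M D * (T + 1) * Real.log γ) with hb
  set c : ℝ := -(β₂ n p M D * Real.log (1 - γ)) + β₄ n p γ ε M D with hc
  have ha0 : 0 ≤ a := by positivity
  have hb0 : 0 ≤ b := by
    rw [hb, ← mul_neg]
    exact mul_nonneg (by positivity) (by linarith [Real.log_nonpos hγ0.le hγ1.le])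
  have hc0 : 0 ≤ c := by
    rw [hc, ← mul_neg]
    exact add_nonneg (mul_nonneg hβ₂
      (by linarith [Real.log_nonpos h1γ.le (by linarith : 1 - γ ≤ 1)])) hβ₄
  set E := LQT.predictionError γ ε M r Sinit with hE
  set w := Wtilde sys W with hw
  have hw0 : 0 ≤ w := le_min (Nat.cast_nonneg _) (by
    rw [inv_nonneg]
    linarith)
  -- Cauchy–Schwarz with weights `ρ^i`, whose total is at most `W̃`.
  have hcs : ∀ t ∈ Finset.range T, (∑ i ∈ Finset.range (min W (T - t)), sys.rho ^ i * E (i + 1) t) ^ 2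
      ≤ w * ∑ i ∈ Finset.range (min W (T - t)), sys.rho ^ i * E (i + 1) t ^ 2 := fun t _ => by
    refine (Finset.sum_sq_le_sum_mul_sum_of_sq_le_mul (Finset.range (min W (T - t)))
      (f := fun i => sys.rho ^ i) (g := fun i => sys.rho ^ i * E (i + 1) t ^ 2)
      (fun i _ => by positivity) (fun i _ => by positivity) (fun i _ => le_of_eq (by ring))).trans ?_
    gcongr
    refine le_trans ?_ (sum_pow_le hρ0 hρ1 W)
    exact Finset.sum_le_sum_of_subset_of_nonneg (by simp) fun _ _ _ => by positivity
  -- For fixed `i` the admissible times are `t < T - i`, exactly the range over which the error of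
  -- the `(i+1)`-step predictor was bounded.
  have hswap : ∑ t ∈ Finset.range T, ∑ i ∈ Finset.range (min W (T - t)),
        sys.rho ^ i * E (i + 1) t ^ 2
      = ∑ i ∈ Finset.range W, sys.rho ^ i * ∑ t ∈ Finset.range (T - i), E (i + 1) t ^ 2 := by
    simp only [Finset.mul_sum]
    refine Finset.sum_comm' fun t i => ?_
    simp only [Finset.mem_range]
    omega
  have herr : ∑ i ∈ Finset.range W, sys.rho ^ i * ∑ t ∈ Finset.range (T - i), E (i + 1) t ^ 2
      ≤ 2 * w ^ 3 * a + w * b + w ^ 2 * c := by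
    calc _ ≤ ∑ i ∈ Finset.range W, sys.rho ^ i *
          (((i + 1 : ℕ) : ℝ) ^ 2 * a + b + ((i + 1 : ℕ) : ℝ) * c) := by
          refine Finset.sum_le_sum fun i hi => ?_
          rw [Finset.mem_range] at hi
          have := sum_predictionError_sq_le hp hγ0 hγ1 hε hM hr hdyn hS hSinit
            (k := i + 1) (by omega) (by omega)
          rw [show T + 1 - (i + 1) = T - i by omega] at this
          gcongr
      _ = (∑ i ∈ Finset.range W, ((i + 1 : ℕ) : ℝ) ^ 2 * sys.rho ^ i) * a
          + (∑ i ∈ Finset.range W, sys.rho ^ i) * b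
          + (∑ i ∈ Finset.range W, ((i + 1 : ℕ) : ℝ) * sys.rho ^ i) * c := by
          rw [Finset.sum_mul, Finset.sum_mul, Finset.sum_mul, ← Finset.sum_add_distrib,
            ← Finset.sum_add_distrib]
          exact Finset.sum_congr rfl fun i _ => by ring
      _ ≤ _ := by
          gcongr
          · exact sum_sq_mul_pow_le hρ0 hρ1 W
          · exact sum_pow_le hρ0 hρ1 W
          · exact sum_mul_pow_le hρ0 hρ1 W
  rw [LQT.regret_eq_sum hX hR]
  calc _ ≤ ∑ t ∈ Finset.range T, (α₁ sys D * (sys.rho ^ (2 * W) / (1 - sys.rho) ^ 2)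
        + 2 * sys.c₀ ^ 2 * ‖sys.Sig‖ *
          (w * ∑ i ∈ Finset.range (min W (T - t)), sys.rho ^ i * E (i + 1) t ^ 2)) := by
        refine Finset.sum_le_sum fun t ht => ?_
        refine (LQT.qform_plot_sub_optimalPolicy_le hn hX hQ hR
          (fun t ht => hr t (by omega) (by omega)) _).trans ?_
        gcongr
        exact hcs t ht
    _ = α₁ sys D * (sys.rho ^ (2 * W) / (1 - sys.rho) ^ 2) * T
        + 2 * sys.c₀ ^ 2 * ‖sys.Sig‖ * (w * ∑ i ∈ Finset.range W, sys.rho ^ i *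
          ∑ t ∈ Finset.range (T - i), E (i + 1) t ^ 2) := by
        rw [Finset.sum_add_distrib, Finset.sum_const, Finset.card_range, nsmul_eq_mul,
          ← Finset.mul_sum, ← Finset.mul_sum, hswap, mul_comm (T : ℝ)]
    _ ≤ α₁ sys D * (sys.rho ^ (2 * W) / (1 - sys.rho) ^ 2) * T
        + 2 * sys.c₀ ^ 2 * ‖sys.Sig‖ * (w * (2 * w ^ 3 * a + w * b + w ^ 2 * c)) := by
        gcongr
    _ = _ := by
        rw [α₂, α₃, α₄, α₅, ha, hb, hc]
        ring
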